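/- Let $Q$ be a complex polynomial. A zero of $Q$ is called a turning point. A Stokes curve emanating from a turning point $a$ is a curve starting at $a$ along which $\int_a^x\sqrt{Q(\tau)}\,d\tau$ is real, followed until it ends at $\infty$ or at a turning point; a Stokes domain is an open connected component of the complement in $\mathbb C$ of the union of all Stokes curves and all turning points. Let $\Omega$ be a Stokes domain and $a\in\partial\Omega$ a turning point. Fix a holomorphic branch of $\sqrt{Q}$ on $\Omega$, put $\mathfrak S_a(x)=\int_a^x\sqrt{Q(\tau)}\,d\tau$ for $x\in\Omega$, and suppose that $\operatorname{Im}\mathfrak S_a>0$ on $\Omega$. Let $\mu=\sup_{\Omega}\operatorname{Im}\mathfrak S_a\in(0,+\infty]$ and, for $\delta>0$, $\Omega_\delta=\{x\in\Omega:\ \delta<\operatorname{Im}\mathfrak S_a(x)<\mu-\delta\}$. Let $\sigma\in\{+1,-1\}$ and $s_0=\sigma\sqrt{Q}$. The formal WKB series $\sum_{n\ge0}s_n(x)h^n$ is the formal solution of the Riccati equation $hS'+S^2-Q=0$ with leading coefficient $s_0$, that is, $s_1=-\dfrac{Q'}{4Q}$ and $$s_n=-\frac1{2s_0}\Big(\sum_{i+j=n,\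 i,j>0}s_is_j+s_{n-1}'\Big)\qquad(n\ge2).$$ Let $C=-(s_1'+s_1^2)$, and for $x\in\Omega$ let $t\mapsto\varphi(t,x)$, $-\infty<t<\infty$, be the solution in $\Omega$ of $y'=1/\sqrt{Q(y)}$, $y(0)=x$. For $h>0$ put $$(K_+f)(x)=\sqrt{Q(x)}\int_{-\infty}^0e^{2t/h}\,\frac{f(\varphi(t,x))}{Q(\varphi(t,x))}\,dt,\qquad (K_-f)(x)=\sqrt{Q(x)}\int_{+\infty}^0e^{-2t/h}\,\frac{f(\varphi(t,x))}{Q(\varphi(t,x))}\,dt,$$ and let $K=K_+$ if $\sigma=1$, $K=K_-$ if $\sigma=-1$. Let $W_1=KC$, $W_n=-\sum_{i+j=n,\ i,j>0}K(W_iW_j)$ for $n\ge2$, $W=\sum_{n\ge1}W_n$, and $$S(x,h)=s_0(x)-\frac{Q'(x)}{4Q(x)}\,h+h\,W(x,h).$$ Then for every $\delta>0$ there is $H>0$ such that for $0<h<H$ the series $W$ converges on $\Omega_\delta$ and $S(\cdot,h)$ is holomorphic on $\Omega_\delta$ and satisfies $hS'+S^2-Q=0$ there. Moreover $$S(x,h)\sim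 s_0(x)-\frac{Q'(x)}{4Q(x)}\,h+\sum_{n=2}^\infty s_n(x)h^n\qquad(h\to0+),$$ in the following sense: all $s_n$ are holomorphic in $\Omega$, and for every $\delta>0$ there is $H(\delta)>0$ such that $S(\cdot,h)$ is holomorphic in $\Omega_\delta$ for $0<h<H(\delta)$ and for every $N\ge0$ there is a constant $C_N(\delta)$ with $$\Big|S(x,h)-\sum_{n=0}^Ns_n(x)h^n\Big|\le C_N(\delta)\,h^{N+1}\qquad\text{for all }x\in\Omega_\delta,\ 0<h<H(\delta).$$ -/

import Mathlib

open Polynomial Filter Topology Set MeasureTheory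

namespace WKB

noncomputable section

/-- The union of all Stokes curves of `Q`, the turning points (zeros of `Q`) included.
A Stokes curve emanating from a turning point `a` is a curve `γ` starting at `a` along which
`∫_a^x √Q` is real. It is parametrized by the modulus of this integral, so that
`√Q(γ) γ' = ± 1`, that is `Q(γ) (γ')² = 1`; it may be followed until it reaches a turning point. -/
def stokesSet (Q : ℂ[X]) : Set ℂ :=
  {x | ∃ (γ : ℝ → ℂ) (T : ℝ), 0 ≤ T ∧ ContinuousOn γ (Icc 0 T) ∧ Q.IsRoot (γ 0) ∧ γ T = x ∧
    ∀ t ∈ Ioo 0 T, ¬ Q.IsRoot (γ t) ∧ ∃ v : ℂ, HasDerivAt γ v t ∧ Q.eval (γ t) * v ^ 2 = 1}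

/-- The Stokes domains: the regions into which the Stokes curves divide the plane. -/
def IsStokesDomain (Q : ℂ[X]) (Ω : Set ℂ) : Prop :=
  IsOpen Ω ∧ ∃ x ∈ (stokesSet Q)ᶜ, Ω = connectedComponentIn (stokesSet Q)ᶜ x

/-- `r` is a holomorphic branch of `√Q` on `Ω`. -/
def IsSqrtBranch (Q : ℂ[X]) (Ω : Set ℂ) (r : ℂ → ℂ) : Prop :=
  DifferentiableOn ℂ r Ω ∧ ∀ x ∈ Ω, r x ^ 2 = Q.eval x

/-- `A` is the function `x ↦ ∫_a^x r(τ) dτ` on `Ω`, where `a` is a boundary point of `Ω`: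
the primitive of `r` on `Ω` that vanishes at `a`. -/
def IsIntegralFrom (Ω : Set ℂ) (a : ℂ) (r A : ℂ → ℂ) : Prop :=
  (∀ x ∈ Ω, HasDerivAt A (r x) x) ∧ Tendsto A (𝓝[Ω] a) (𝓝 0)

/-- `Ω_δ = {x ∈ Ω : δ < Im A(x) < μ - δ}`, where `μ = sup_Ω Im A`, possibly `+∞`. -/
def innerDomain (Ω : Set ℂ) (A : ℂ → ℂ) (δ : ℝ) : Set ℂ :=
  {x ∈ Ω | δ < (A x).im ∧ (((A x).im + δ : ℝ) : EReal) < ⨆ y ∈ Ω, ((A y).im : EReal)}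

/-- The coefficients `s_n` of the formal series solution `∑ s_n h^n` of `h S' + S² - Q = 0`
with leading coefficient `s₀`:  `s_1 = -Q'/(4Q)` and, for `n ≥ 2`,
`s_n = -(1/(2 s₀)) (∑_{i+j=n, i,j>0} s_i s_j + s_{n-1}')`. -/
def formalCoeff (Q : ℂ[X]) (s₀ : ℂ → ℂ) : ℕ → ℂ → ℂ
  | 0 => s₀
  | 1 => fun x => -(Q.derivative.eval x / (4 * Q.eval x))
  | n + 2 => fun x => -(1 / (2 * s₀ x)) *
      ((∑ i : Fin (n + 1), formalCoeff Q s₀ (i + 1) x * formalCoeff Q s₀ (n + 1 - i) x)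
        + deriv (formalCoeff Q s₀ (n + 1)) x)
  termination_by n => n
  decreasing_by all_goals omega

/-- `C = -(s_1' + s_1²)` with `s_1 = -Q'/(4Q)`. -/
def sourceTerm (Q : ℂ[X]) (x : ℂ) : ℂ :=
  -(deriv (fun y => -(Q.derivative.eval y / (4 * Q.eval y))) x
    + (-(Q.derivative.eval x / (4 * Q.eval x))) ^ 2)

open Classical in
/-- The flow `φ(t,x)` on `Ω`, `-∞ < t < ∞`: the solution of `y' = 1/√Q(y)`, `y(0) = x`,
where `r` is the branch of `√Q` (the value is `x` if there is no solution on the whole line). -/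
def flow (Ω : Set ℂ) (r : ℂ → ℂ) (t : ℝ) (x : ℂ) : ℂ :=
  if H : ∃ y : ℝ → ℂ, y 0 = x ∧ ∀ s, y s ∈ Ω ∧ HasDerivAt y (1 / r (y s)) s then H.choose t else x

/-- The integral operators `K_σ`, `σ = ±1`:
`(K_+ f)(x) = √Q(x) ∫_{-∞}^0 exp(2t/h) f(φ(t,x)) / Q(φ(t,x)) dt` and
`(K_- f)(x) = √Q(x) ∫_{+∞}^0 exp(-2t/h) f(φ(t,x)) / Q(φ(t,x)) dt`,
the second one being written with `-t` in place of `t`. -/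
def intOp (Q : ℂ[X]) (Ω : Set ℂ) (r : ℂ → ℂ) (σ : ℤˣ) (h : ℝ) (f : ℂ → ℂ) (x : ℂ) : ℂ :=
  ((σ : ℤ) : ℂ) * r x * ∫ t in Iic (0 : ℝ), (Real.exp (2 * t / h) : ℂ) *
    (f (flow Ω r (((σ : ℤ) : ℝ) * t) x) / Q.eval (flow Ω r (((σ : ℤ) : ℝ) * t) x))

/-- `W_1 = K_σ C` and `W_n = -∑_{i+j=n, i,j>0} K_σ (W_i W_j)` for `n ≥ 2` (and `W_0 = 0`). -/
def corrTerm (Q : ℂ[X]) (Ω : Set ℂ) (r : ℂ → ℂ) (σ : ℤˣ) (h : ℝ) : ℕ → ℂ → ℂ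
  | 0 => fun _ => 0
  | 1 => intOp Q Ω r σ h (sourceTerm Q)
  | n + 2 => fun x => -∑ i : Fin (n + 1), intOp Q Ω r σ h
      (fun y => corrTerm Q Ω r σ h (i + 1) y * corrTerm Q Ω r σ h (n + 1 - i) y) x
  termination_by n => n
  decreasing_by all_goals omega

/-- `S = s_0 + s_1 h + h W` with `s_0 = σ √Q`, `s_1 = -Q'/(4Q)` and `W = ∑_{n ≥ 1} W_n`. -/
def trueSolution (Q : ℂ[X]) (Ω : Set ℂ) (r : ℂ → ℂ) (σ : ℤˣ) (x : ℂ) (h : ℝ) : ℂ :=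
  ((σ : ℤ) : ℂ) * r x + -(Q.derivative.eval x / (4 * Q.eval x)) * (h : ℂ)
    + (h : ℂ) * ∑' n, corrTerm Q Ω r σ h n x

/-- `ψ(x,h) ∼ ∑ a_n(x) h^n` as `h → 0+`, uniformly on each member of the family `D δ`, `δ > 0`,
of subsets of `Ω`; here the `a_n` are holomorphic in `Ω` and `ψ(·,h)` is holomorphic
in `D δ` for small `h`. -/
def HasAsympExpansion (Ω : Set ℂ) (D : ℝ → Set ℂ) (ψ : ℂ → ℝ → ℂ) (a : ℕ → ℂ → ℂ) : Prop :=
  (∀ n, DifferentiableOn ℂ (a n) Ω) ∧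
  ∀ δ : ℝ, 0 < δ → ∃ H : ℝ, 0 < H ∧
    (∀ h : ℝ, 0 < h → h < H → DifferentiableOn ℂ (fun x => ψ x h) (D δ)) ∧
    ∀ N : ℕ, ∃ C : ℝ, ∀ h : ℝ, 0 < h → h < H → ∀ x ∈ D δ,
      ‖ψ x h - ∑ n ∈ Finset.range (N + 1), a n x * (h : ℂ) ^ n‖ ≤ C * h ^ (N + 1)

end

end WKB

/-! In the coordinate z = A(x) the flow y' = 1/√Q(y) is the translation z ↦ z + t, and K becomes a
one-sided Laplace average along horizontal lines. This works globally because A maps Ω bijectively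
onto the strip 0 < Im z < μ (`exists_isStripChart`). The main point is that horizontal trajectories
in Ω are complete. Far out their speed |Q|^(-1/2) is below 1, so in finite time they stay bounded,
and they even converge (`horizontal_tendsto`). The limit is not on a Stokes curve, since a
horizontal curve ending there lies in the Stokes set near its end (`eventually_mem_stokesSet`). A
local homeomorphism to ℂ from a connected space with complete horizontal lifts is injective
(`injective_of_complete`). By connectedness its image contains every height in (0, μ), and the flow
fills each line.

A disc around A(x) inside the strip keeps x ∈ Ω_δ at a definite distance from the turning points
(`exists_dist_root_bound`), so 1/√Q and Q'/Q are bounded on Ω_δ. Cauchy's estimate in z bounds f'/√Q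
for bounded f. Since √Q itself may be unbounded, estimates carry the weight 1/√Q: if |f/√Q| ≤ M on
Ω_δ, then |Kf| ≤ M h for small h (`norm_intOp_le`). Hence W_n is dominated by a Catalan number times
a power of h², and the series converges. As u = Kf solves u' = f - (2 s_1 + 2 s_0/h) u, summation
gives W' = C - W² - (2 s_1 + 2 s_0/h) W, which is the Riccati equation for S.

For the asymptotics, let P be the formal series cut off after h^N. It solves the Riccati equation up
to a term h^(N+1) ρ, so E = S - P satisfies hE' = -(S + P)E - h^(N+1) ρ, where S + P = 2 s_0 + O(h).
Along the flow, taken in the direction σ, this is u' + (2/h)u = g with u bounded on the whole line,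
whence |E| ≤ (h/2) sup |g| (`norm_le_of_bounded_linear_ode`). Iterating this bound gives E =
O(h^(N+1)). -/

namespace WKB

/-! ### Lifting paths through a local homeomorphism -/

section Lifts

variable {E : Type*} [TopologicalSpace E] [T2Space E] {f : E → ℂ}

/-- Two continuous lifts of a path on a preconnected set agree if they agree at a point. -/
theorem lift_unique (hf : IsLocalHomeomorph f) {α : Type*} [TopologicalSpace α] {s : Set α}
    (hs : IsPreconnected s) {y₁ y₂ : α → E} (h₁ : ContinuousOn y₁ s) (h₂ : ContinuousOn y₂ s)
    (he : ∀ t ∈ s, f (y₁ t) = f (y₂ t)) {t₀ : α} (ht₀ : t₀ ∈ s) (h₀ : y₁ t₀ = y₂ t₀) :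
    ∀ t ∈ s, y₁ t = y₂ t :=
  (T2Space.isSeparatedMap f).eqOn_of_comp_eqOn hf.isLocallyInjective hs h₁ h₂
    (fun t ht => he t ht) ht₀ h₀

/-- Lifts on the initial segments of `J` combine to a lift on `J`. -/
theorem glue_lifts (hf : IsLocalHomeomorph f) {c : ℝ → ℂ} {x : E} {J : Set ℝ}
    (hJ0 : ∀ t ∈ J, 0 ≤ t) (hJ : ∀ t ∈ J, ∃ t' ∈ J, t < t')
    (H : ∀ T ∈ J, ∃ y : ℝ → E, ContinuousOn y (Icc 0 T) ∧ y 0 = x ∧ ∀ t ∈ Icc 0 T, f (y t) = c t)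
    (h0 : (0 : ℝ) ∈ J) :
    ∃ y : ℝ → E, ContinuousOn y J ∧ y 0 = x ∧ ∀ t ∈ J, f (y t) = c t := by
  have : Nonempty E := ⟨x⟩
  choose! Y hYc hY0 hYf using H
  have key : ∀ T ∈ J, ∀ s ∈ J, s ≤ T → Y s s = Y T s := by
    intro T hT s hs hsT
    exact lift_unique hf isPreconnected_Icc (hYc s hs)
      ((hYc T hT).mono (Icc_subset_Icc_right hsT))
      (fun t ht => by rw [hYf s hs t ht, hYf T hT t ⟨ht.1, ht.2.trans hsT⟩])
      (t₀ := 0) ⟨le_rfl, hJ0 s hs⟩ (by rw [hY0 s hs, hY0 T hT]) s ⟨hJ0 s hs, le_rfl⟩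
  refine ⟨fun t => Y t t, ?_, hY0 0 h0, fun t ht => hYf t ht t ⟨hJ0 t ht, le_rfl⟩⟩
  intro t ht
  obtain ⟨t', ht', htt'⟩ := hJ t ht
  have h1 : ContinuousWithinAt (Y t') (Icc 0 t') t := hYc t' ht' t ⟨hJ0 t ht, htt'.le⟩
  have hm : Iio t' ∩ J ∈ 𝓝[J] t := inter_mem (mem_nhdsWithin_of_mem_nhds (Iio_mem_nhds htt')) self_mem_nhdsWithin
  have h2 : ContinuousWithinAt (Y t') J t := by
    refine h1.mono_of_mem_nhdsWithin (mem_of_superset hm ?_)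
    rintro s ⟨hs, hsJ⟩
    exact ⟨hJ0 s hsJ, le_of_lt hs⟩
  refine h2.congr_of_eventuallyEq (mem_of_superset hm ?_) (key t' ht' t ht htt'.le)
  rintro s ⟨hs, hsJ⟩
  exact key t' ht' s hsJ (le_of_lt hs)

/-- A path lifts to `[0, ∞)` if all its partial lifts converge at the end. -/
theorem exists_lift_Ici (hf : IsLocalHomeomorph f) {c : ℝ → ℂ} (hc : Continuous c) {x : E}
    (hx : f x = c 0)
    (hlim : ∀ T : ℝ, 0 < T → ∀ y : ℝ → E, ContinuousOn y (Ico 0 T) → y 0 = x →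
      (∀ t ∈ Ico 0 T, f (y t) = c t) → ∃ q, Tendsto y (𝓝[<] T) (𝓝 q)) :
    ∃ y : ℝ → E, ContinuousOn y (Ici 0) ∧ y 0 = x ∧ ∀ t ∈ Ici (0 : ℝ), f (y t) = c t := by
  classical
  set P : ℝ → Prop := fun T => ∃ y : ℝ → E, ContinuousOn y (Icc 0 T) ∧ y 0 = x ∧
    ∀ t ∈ Icc 0 T, f (y t) = c t with hP
  have hmono : ∀ S T, S ≤ T → P T → P S := by
    rintro S T hST ⟨y, hy, hy0, hyf⟩
    exact ⟨y, hy.mono (Icc_subset_Icc_right hST), hy0, fun t ht => hyf t ⟨ht.1, ht.2.trans hST⟩⟩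
  have hP0 : P 0 := ⟨fun _ => x, continuousOn_const, rfl, fun t ht => by
    have : t = 0 := le_antisymm ht.2 ht.1
    rw [this, hx]⟩
  have hext : ∀ T, 0 ≤ T → P T → ∃ T' > T, P T' := by
    rintro T hT ⟨y, hy, hy0, hyf⟩
    obtain ⟨e, heq, hfe⟩ := hf (y T)
    have hcT : c T ∈ e.target := by
      rw [← hyf T ⟨hT, le_rfl⟩, hfe]; exact e.map_source heq
    obtain ⟨ε, hε, hball⟩ := Metric.mem_nhds_iff.1
      ((hc.continuousAt (x := T)).preimage_mem_nhds (e.open_target.mem_nhds hcT))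
    have htar : ∀ t ∈ Icc T (T + ε / 2), c t ∈ e.target := by
      intro t ht
      apply hball
      rw [Metric.mem_ball, Real.dist_eq, abs_of_nonneg (by linarith [ht.1])]
      linarith [ht.2]
    refine ⟨T + ε / 2, by linarith, fun t => if t ≤ T then y t else e.symm (c t), ?_, ?_, ?_⟩
    · have hu : Icc 0 (T + ε / 2) = Icc 0 T ∪ Icc T (T + ε / 2) :=
        (Icc_union_Icc_eq_Icc hT (by linarith)).symm
      rw [hu]
      refine ContinuousOn.union_of_isClosed ?_ ?_ isClosed_Icc isClosed_Icc
      · exact hy.congr (fun t ht => by simp [ht.2])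
      · have : ContinuousOn (fun t => e.symm (c t)) (Icc T (T + ε / 2)) :=
          e.continuousOn_symm.comp hc.continuousOn (fun t ht => htar t ht)
        refine this.congr (fun t ht => ?_)
        by_cases h : t ≤ T
        · have htT : t = T := le_antisymm h ht.1
          subst htT
          simp only [le_refl, if_true]
          rw [← hyf t ⟨hT, le_rfl⟩, hfe, e.left_inv heq]
        · simp [h]
    · simp [hT, hy0]
    · intro t ht
      by_cases h : t ≤ T
      · simp only [h, if_true]; exact hyf t ⟨ht.1, h⟩
      · simp only [h, if_false]
        rw [hfe, e.right_inv (htar t ⟨(not_le.1 h).le, ht.2⟩)]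
  -- At the infimum `T₀` of the failing times, the shorter lifts glue to a lift on `[0, T₀)`; `hlim`
  -- closes it up at `T₀`, and `hext` then passes beyond `T₀`.
  have hall : ∀ T, 0 ≤ T → P T := by
    by_contra! hne
    obtain ⟨T₁, hT₁, hPT₁⟩ := hne
    set S : Set ℝ := {T | 0 ≤ T ∧ ¬ P T} with hS
    have hSne : S.Nonempty := ⟨T₁, hT₁, hPT₁⟩
    have hSb : BddBelow S := ⟨0, fun T hT => hT.1⟩
    set T₀ := sInf S with hT₀
    have hT₀0 : 0 ≤ T₀ := le_csInf hSne fun T hT => hT.1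
    have hlt : ∀ T, 0 ≤ T → T < T₀ → P T := by
      intro T h0 hT
      by_contra h
      exact absurd (csInf_le hSb ⟨h0, h⟩) (not_le.2 hT)
    have hPT₀ : P T₀ := by
      rcases hT₀0.eq_or_lt with h | hpos
      · rw [← h]; exact hP0
      obtain ⟨y, hy, hy0, hyf⟩ := glue_lifts hf (c := c) (x := x) (J := Ico 0 T₀)
        (fun t ht => ht.1)
        (fun t ht => ⟨(t + T₀) / 2, ⟨by linarith [ht.1], by linarith [ht.2]⟩, by linarith [ht.2]⟩)
        (fun T hT => hlt T hT.1 hT.2) ⟨le_rfl, hpos⟩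
      obtain ⟨q, hq⟩ := hlim T₀ hpos y hy hy0 hyf
      have hq' : f q = c T₀ := by
        have h1 : Tendsto (fun t => f (y t)) (𝓝[<] T₀) (𝓝 (f q)) :=
          (hf.continuous.tendsto q).comp hq
        have h2 : Tendsto c (𝓝[<] T₀) (𝓝 (c T₀)) := (hc.tendsto T₀).mono_left nhdsWithin_le_nhds
        refine tendsto_nhds_unique h1 (h2.congr' ?_)
        filter_upwards [Ico_mem_nhdsLT hpos] with t ht using (hyf t ht).symm
      refine ⟨Function.update y T₀ q, ?_, by rw [Function.update_of_ne hpos.ne]; exact hy0, ?_⟩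
      · rw [continuousOn_update_iff]
        have hd : Icc 0 T₀ \ {T₀} = Ico 0 T₀ := Icc_sdiff_right
        rw [hd]
        exact ⟨hy, fun _ => hq.mono_left (nhdsWithin_mono _ Ico_subset_Iio_self)⟩
      · intro t ht
        rcases ht.2.eq_or_lt with h | h
        · rw [h, Function.update_self]; exact hq'
        · rw [Function.update_of_ne h.ne]; exact hyf t ⟨ht.1, h⟩
    obtain ⟨T', hT', hPT'⟩ := hext T₀ hT₀0 hPT₀
    obtain ⟨T, hT, hTT'⟩ := exists_lt_of_csInf_lt hSne hT'
    exact hT.2 (hmono T T' hTT'.le hPT')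
  exact glue_lifts hf (fun t ht => ht) (fun t ht => ⟨t + 1, by
    have : (0:ℝ) ≤ t := ht
    show (0:ℝ) ≤ t + 1
    linarith, by linarith⟩)
    (fun T hT => hall T hT) self_mem_Ici

/-- Complete horizontal lifts of a local homeomorphism form a continuous flow. -/
theorem exists_flow (hf : IsLocalHomeomorph f)
    (H : ∀ x : E, ∃ y : ℝ → E, Continuous y ∧ y 0 = x ∧ ∀ t : ℝ, f (y t) = f x + t) :
    ∃ φ : ℝ → E → E, Continuous (fun p : ℝ × E => φ p.1 p.2) ∧ (∀ x, φ 0 x = x) ∧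
      ∀ t x, f (φ t x) = f x + t := by
  choose φ hφc hφ0 hφf using H
  refine ⟨fun t x => φ x t, ?_, hφ0, fun t x => hφf x t⟩
  -- Joint continuity comes from homotopy lifting: scale the time by a parameter in `[0,1]`. At
  -- parameter 0 the lift is the continuous projection to `x`; at parameter 1 it is the flow.
  let F : C(unitInterval × (ℝ × E), ℂ) :=
    ⟨fun p => f p.2.2 + ((p.1 : ℝ) * p.2.1 : ℝ), by
      have := hf.continuous
      fun_prop⟩
  have hg := hf.continuous_lift (T2Space.isSeparatedMap f) F
    (g := fun p => φ p.2.2 ((p.1 : ℝ) * p.2.1)) (by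
      ext p; simp only [Function.comp_apply, hφf]; rfl)
    (by simpa [hφ0] using continuous_snd)
    (fun a => (hφc a.2).comp (by fun_prop))
  have h1 := hg.comp (Continuous.prodMk_right (X := unitInterval) (Y := ℝ × E) 1)
  refine h1.congr (fun p => ?_)
  simp

end Lifts


/-! ### Injectivity from complete horizontal lifts -/

section Tubes

variable {E : Type*} [TopologicalSpace E] [T2Space E] {f : E → ℂ}

/-- An open set mapped bijectively by `f` onto a union of horizontal lines with connected set of
heights. -/
def IsTube (f : E → ℂ) (U : Set E) : Prop :=
  IsOpen U ∧ InjOn f U ∧ ∃ I : Set ℝ, I.OrdConnected ∧ f '' U = Complex.im ⁻¹' I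

theorem convex_im_preimage {I : Set ℝ} (hI : I.OrdConnected) : Convex ℝ (Complex.im ⁻¹' I) :=
  hI.convex.linear_preimage Complex.imLm

/-- The inverse branches of `f` on `U` and on `V` agree at the image of a common point. The overlap
of the two images is again a union of lines over an interval, hence connected, so they agree on all
of it, and no value is taken at two different points of the union. -/
theorem isTube_union (hf : IsLocalHomeomorph f) {U V : Set E} (hU : IsTube f U)
    (hV : IsTube f V) (hUV : (U ∩ V).Nonempty) : IsTube f (U ∪ V) := by
  obtain ⟨hUo, hUi, I, hI, hUI⟩ := hU
  obtain ⟨hVo, hVi, J, hJ, hVJ⟩ := hV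
  obtain ⟨p, hpU, hpV⟩ := hUV
  have hpI : (f p).im ∈ I := by
    have : f p ∈ f '' U := mem_image_of_mem f hpU
    rwa [hUI] at this
  have hpJ : (f p).im ∈ J := by
    have : f p ∈ f '' V := mem_image_of_mem f hpV
    rwa [hVJ] at this
  have hkey : ∀ u ∈ U, ∀ v ∈ V, f u = f v → u = v := by
    have : Nonempty E := ⟨p⟩
    set gU := Function.invFunOn f U with hgU
    set gV := Function.invFunOn f V with hgV
    have gU_mem : ∀ z ∈ f '' U, gU z ∈ U ∧ f (gU z) = z := fun z hz =>
      ⟨Function.invFunOn_mem hz, Function.invFunOn_eq hz⟩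
    have gV_mem : ∀ z ∈ f '' V, gV z ∈ V ∧ f (gV z) = z := fun z hz =>
      ⟨Function.invFunOn_mem hz, Function.invFunOn_eq hz⟩
    have gcont : ∀ W : Set E, IsOpen W → InjOn f W → 
        ContinuousOn (Function.invFunOn f W) (f '' W) := by
      intro W hW hWi
      rw [continuousOn_iff']
      intro t ht
      refine ⟨f '' (t ∩ W), hf.isOpenMap _ (ht.inter hW), ?_⟩
      ext z
      constructor
      · rintro ⟨hz, hzW⟩
        exact ⟨⟨_, ⟨hz, Function.invFunOn_mem hzW⟩, Function.invFunOn_eq hzW⟩, hzW⟩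
      · rintro ⟨⟨q, ⟨hq, hqW⟩, rfl⟩, hzW⟩
        refine ⟨?_, hzW⟩
        have : Function.invFunOn f W (f q) = q :=
          hWi (Function.invFunOn_mem hzW) hqW (Function.invFunOn_eq hzW)
        rw [mem_preimage, this]; exact hq
    have hconv : IsPreconnected (f '' U ∩ f '' V) := by
      rw [hUI, hVJ, ← preimage_inter]
      exact (convex_im_preimage (hI.inter hJ)).isPreconnected
    have hagree := lift_unique hf hconv ((gcont U hUo hUi).mono inter_subset_left)
      ((gcont V hVo hVi).mono inter_subset_right)
      (fun z hz => by
        show f (gU z) = f (gV z)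
        rw [(gU_mem z hz.1).2, (gV_mem z hz.2).2])
      (t₀ := f p) ⟨mem_image_of_mem f hpU, mem_image_of_mem f hpV⟩
      (by
        have h1 : gU (f p) = p := hUi (gU_mem _ (mem_image_of_mem f hpU)).1 hpU
          (gU_mem _ (mem_image_of_mem f hpU)).2
        have h2 : gV (f p) = p := hVi (gV_mem _ (mem_image_of_mem f hpV)).1 hpV
          (gV_mem _ (mem_image_of_mem f hpV)).2
        show gU (f p) = gV (f p)
        rw [h1, h2])
    intro u hu v hv huv
    have h1 : gU (f u) = u := hUi (gU_mem _ (mem_image_of_mem f hu)).1 hu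
      (gU_mem _ (mem_image_of_mem f hu)).2
    have h2 : gV (f v) = v := hVi (gV_mem _ (mem_image_of_mem f hv)).1 hv
      (gV_mem _ (mem_image_of_mem f hv)).2
    have h3 := hagree (f u) ⟨mem_image_of_mem f hu, huv ▸ mem_image_of_mem f hv⟩
    rw [← h1, ← h2, ← huv]; exact h3
  refine ⟨hUo.union hVo, ?_, I ∪ J, ?_, by rw [image_union, hUI, hVJ, preimage_union]⟩
  · rintro u (hu | hu) v (hv | hv) huv
    · exact hUi hu hv huv
    · exact hkey u hu v hv huv
    · exact (hkey v hv u hu huv.symm).symm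
    · exact hVi hu hv huv
  · exact (hI.isPreconnected.union _ hpI hpJ hJ.isPreconnected).ordConnected

theorem flow_apply_of_eq (hf : IsLocalHomeomorph f) {φ : ℝ → E → E}
    (hφc : Continuous (fun p : ℝ × E => φ p.1 p.2)) (hφf : ∀ t x, f (φ t x) = f x + t)
    {s : Set ℝ} (hs : IsPreconnected s) {y : ℝ → E} (hy : ContinuousOn y s) {x : E}
    (hyf : ∀ t ∈ s, f (y t) = f x + t) {t₀ : ℝ} (ht₀ : t₀ ∈ s) (h : y t₀ = φ t₀ x) :
    ∀ t ∈ s, y t = φ t x :=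
  lift_unique hf hs hy
    (hφc.comp (Continuous.prodMk_left (Y := E) x)).continuousOn
    (fun t ht => by rw [hyf t ht]; exact (hφf t x).symm) ht₀ h

/-- Every point lies in a tube. -/
theorem exists_isTube (hf : IsLocalHomeomorph f) {φ : ℝ → E → E}
    (hφc : Continuous (fun p : ℝ × E => φ p.1 p.2)) (hφ0 : ∀ x, φ 0 x = x)
    (hφf : ∀ t x, f (φ t x) = f x + t) (p : E) : ∃ U, IsTube f U ∧ p ∈ U := by
  obtain ⟨e, hpe, hfe⟩ := hf p
  have htar : f p ∈ e.target := by rw [hfe]; exact e.map_source hpe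
  obtain ⟨ε, hε, hball⟩ := Metric.isOpen_iff.1 e.open_target _ htar
  set N : Set E := e.source ∩ f ⁻¹' Metric.ball (f p) ε with hN
  have hNo : IsOpen N := e.open_source.inter (Metric.isOpen_ball.preimage hf.continuous)
  have hpN : p ∈ N := ⟨hpe, Metric.mem_ball_self hε⟩
  have hNi : InjOn f N := by rw [hfe]; exact e.injOn.mono inter_subset_left
  have hsymm : ∀ z ∈ Metric.ball (f p) ε, e.symm z ∈ N ∧ f (e.symm z) = z := by
    intro z hz
    have h2 : f (e.symm z) = z := by rw [hfe, e.right_inv (hball hz)]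
    refine ⟨⟨e.map_target (hball hz), ?_⟩, h2⟩
    rw [mem_preimage, h2]; exact hz
  have hφt : ∀ t, Continuous (φ t) := fun t => hφc.comp (Continuous.prodMk_right t)
  have hcancel : ∀ t s q, φ s (φ t q) = φ (t + s) q := by
    intro t s q
    have := flow_apply_of_eq hf hφc hφf (s := univ) isPreconnected_univ
      (y := fun s => φ (t + s) q) (x := φ t q)
      ((hφc.comp (g := fun p : ℝ × E => φ p.1 p.2) (f := fun s : ℝ => (t + s, q))
        (by fun_prop)).continuousOn)
      (fun s _ => by rw [hφf, hφf]; push_cast; ring) (t₀ := 0) (mem_univ _)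
      (by rw [hφ0, add_zero]) s (mem_univ _)
    exact this.symm
  -- The tube is the saturation under the flow of a chart neighbourhood `N` that maps onto a disc.
  refine ⟨{q | ∃ t, φ t q ∈ N}, ⟨?_, ?_, Ioo ((f p).im - ε) ((f p).im + ε), ordConnected_Ioo, ?_⟩,
    0, by rw [hφ0]; exact hpN⟩
  · have : {q | ∃ t, φ t q ∈ N} = ⋃ t, φ t ⁻¹' N := by ext; simp
    rw [this]
    exact isOpen_iUnion fun t => hNo.preimage (hφt t)
  · rintro q₁ ⟨t₁, h₁⟩ q₂ ⟨t₂, h₂⟩ hq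
    -- The line through `f q₁ = f q₂` meets the disc in a segment. Its lift inside `N` is the flow
    -- line of `q₁` from time `t₁` to `t₂`, so both points flow to the same point of `N` at time
    -- `t₂`; flowing back gives `q₁ = q₂`.
    have hseg : IsPreconnected {t : ℝ | f q₁ + t ∈ Metric.ball (f p) ε} := by
      have : Convex ℝ ((fun t : ℝ => f q₁ + (t : ℂ)) ⁻¹' Metric.ball (f p) ε) :=
        (convex_ball (f p) ε).affine_preimage
          ((AffineMap.const ℝ ℝ (f q₁)) + (Complex.ofRealCLM : ℝ →ₗ[ℝ] ℂ).toAffineMap)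
      exact this.isPreconnected
    have hb1 : f q₁ + t₁ ∈ Metric.ball (f p) ε := by rw [← hφf]; exact h₁.2
    have hb2 : f q₁ + t₂ ∈ Metric.ball (f p) ε := by rw [hq, ← hφf]; exact h₂.2
    have hc : ContinuousOn (fun t : ℝ => e.symm (f q₁ + t))
        {t : ℝ | f q₁ + t ∈ Metric.ball (f p) ε} :=
      e.continuousOn_symm.comp (by fun_prop) (fun t ht => hball ht)
    have := flow_apply_of_eq hf hφc hφf hseg hc (x := q₁) (fun t ht => (hsymm _ ht).2)
      (t₀ := t₁) hb1 (hNi (hsymm _ hb1).1 h₁ (by rw [(hsymm _ hb1).2, hφf])) t₂ hb2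
    have h3 : φ t₂ q₁ = φ t₂ q₂ := by
      rw [← this]
      exact hNi (hsymm _ hb2).1 h₂ (by rw [(hsymm _ hb2).2, hφf, hq])
    have h4 := congrArg (φ (-t₂)) h3
    rwa [hcancel, hcancel, add_neg_cancel, hφ0, hφ0] at h4
  · ext z
    constructor
    · rintro ⟨q, ⟨t, ht⟩, rfl⟩
      have h1 : ‖f (φ t q) - f p‖ < ε := by
        have := ht.2
        rwa [mem_preimage, Metric.mem_ball, dist_eq_norm] at this
      have h2 := (Complex.abs_im_le_norm _).trans_lt h1
      rw [hφf] at h2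
      simp only [Complex.sub_im, Complex.add_im, Complex.ofReal_im, add_zero] at h2
      rw [abs_lt] at h2
      exact ⟨by linarith, by linarith⟩
    · rintro ⟨hz1, hz2⟩
      set w : ℂ := ⟨(f p).re, z.im⟩ with hw
      have hwb : w ∈ Metric.ball (f p) ε := by
        rw [Metric.mem_ball, Complex.dist_of_re_eq (by simp [hw]), Real.dist_eq, abs_lt]
        exact ⟨by simp only [hw]; linarith, by simp only [hw]; linarith⟩
      obtain ⟨hwN, hfw⟩ := hsymm w hwb
      refine ⟨φ (z.re - w.re) (e.symm w), ⟨-(z.re - w.re), ?_⟩, ?_⟩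
      · rw [hcancel, add_neg_cancel, hφ0]; exact hwN
      · rw [hφf, hfw]
        apply Complex.ext <;> simp [hw]

/-- A local homeomorphism to `ℂ` from a connected Hausdorff space is injective if it admits
complete horizontal lifts. -/
theorem injective_of_complete [PreconnectedSpace E] (hf : IsLocalHomeomorph f)
    (H : ∀ x : E, ∃ y : ℝ → E, Continuous y ∧ y 0 = x ∧ ∀ t : ℝ, f (y t) = f x + t) :
    Function.Injective f := by
  obtain ⟨φ, hφc, hφ0, hφf⟩ := exists_flow hf H
  intro x y hxy
  -- Lying in a common tube is a locally true, symmetric and, by `isTube_union`, transitive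
  -- relation, hence it holds for all pairs.
  obtain ⟨U, hU, hxU, hyU⟩ := isPreconnected_univ.induction₂ (s := (univ : Set E))
    (fun x y => ∃ U, IsTube f U ∧ x ∈ U ∧ y ∈ U)
    (fun x _ => by
      obtain ⟨U, hU, hx⟩ := exists_isTube hf hφc hφ0 hφf x
      rw [nhdsWithin_univ]
      filter_upwards [hU.1.mem_nhds hx] with y hy using ⟨U, hU, hx, hy⟩)
    (fun x y z _ _ _ ⟨U, hU, hxU, hyU⟩ ⟨V, hV, hyV, hzV⟩ =>
      ⟨U ∪ V, isTube_union hf hU hV ⟨y, hyU, hyV⟩, Or.inl hxU, Or.inr hzV⟩)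
    (fun x y _ _ ⟨U, hU, hx, hy⟩ => ⟨U, hU, hy, hx⟩) (mem_univ x) (mem_univ y)
  exact hU.2.1 hxU hyU hxy

end Tubes


/-! ### Horizontal curves in local coordinates and the Stokes set -/

section Charts

/-- A holomorphic function is a local homeomorphism where its derivative does not vanish. -/
theorem exists_partialHomeomorph {f d : ℂ → ℂ} {U : Set ℂ} (hU : IsOpen U)
    (hf : ∀ x ∈ U, HasDerivAt f (d x) x) {p : ℂ} (hp : p ∈ U) (hd : d p ≠ 0) :
    ∃ e : OpenPartialHomeomorph ℂ ℂ, p ∈ e.source ∧ e.source ⊆ U ∧ (e : ℂ → ℂ) = f := by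
  have han : AnalyticAt ℂ f p :=
    (show DifferentiableOn ℂ f U from fun x hx =>
      (hf x hx).differentiableAt.differentiableWithinAt).analyticAt (hU.mem_nhds hp)
  have hs : HasStrictDerivAt f (d p) p := by
    have := han.hasStrictDerivAt
    rwa [(hf p hp).deriv] at this
  have hs' := hs.hasStrictFDerivAt_equiv hd
  refine ⟨(hs'.toOpenPartialHomeomorph f).restrOpen U hU, ⟨hs'.mem_toOpenPartialHomeomorph_source,
    hp⟩, fun x hx => hx.2, rfl⟩

/-- The derivative of a lift of a curve through a holomorphic function. -/
theorem hasDerivAt_lift {f d : ℂ → ℂ} {U : Set ℂ} (hU : IsOpen U)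
    (hf : ∀ x ∈ U, HasDerivAt f (d x) x) {y c : ℝ → ℂ} {t : ℝ} {c' : ℂ}
    (hy : ContinuousAt y t) (hyU : y t ∈ U) (hd : d (y t) ≠ 0) (hc : HasDerivAt c c' t)
    (hfy : ∀ᶠ s in 𝓝 t, f (y s) = c s) : HasDerivAt y ((d (y t))⁻¹ * c') t := by
  obtain ⟨e, hpe, heU, hef⟩ := exists_partialHomeomorph hU hf hyU hd
  have hct : e (y t) = c t := by rw [hef]; exact hfy.self_of_nhds
  have hsymm : HasDerivAt e.symm (d (y t))⁻¹ (c t) := by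
    rw [← hct]
    refine e.hasDerivAt_symm (e.map_source hpe) hd ?_
    rw [e.left_inv hpe, hef]
    exact hf _ hyU
  refine (hsymm.comp t hc).congr_of_eventuallyEq ?_
  filter_upwards [hfy, hy.preimage_mem_nhds (e.open_source.mem_nhds hpe)] with s hs hse
  rw [Function.comp_apply, ← hs, ← hef, e.left_inv hse]

/-- Near a point that is not a turning point, the integral of a branch of `√Q` is a
local coordinate. -/
theorem exists_chart (Q : ℂ[X]) {p : ℂ} (hp : ¬ Q.IsRoot p) :
    ∃ (e : OpenPartialHomeomorph ℂ ℂ) (b : ℂ → ℂ), p ∈ e.source ∧ e p = 0 ∧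
      ∀ x ∈ e.source, HasDerivAt e (b x) x ∧ b x ^ 2 = Q.eval x ∧ b x ≠ 0 := by
  have hp' : Q.eval p ≠ 0 := hp
  obtain ⟨s, hs⟩ := IsAlgClosed.exists_pow_nat_eq (Q.eval p) (n := 2) (by norm_num)
  -- Dividing by `Q(p)` puts the argument of the principal logarithm near 1, away from its cut.
  set b : ℂ → ℂ := fun x => s * Complex.exp (1 / 2 * Complex.log (Q.eval x / Q.eval p)) with hb
  have hcont : Continuous fun x => Q.eval x / Q.eval p := by fun_prop
  have hmem : (fun x => Q.eval x / Q.eval p) ⁻¹' Complex.slitPlane ∈ 𝓝 p := by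
    refine hcont.continuousAt.preimage_mem_nhds (Complex.isOpen_slitPlane.mem_nhds ?_)
    rw [div_self hp']; exact Complex.one_mem_slitPlane
  obtain ⟨ρ, hρ, hball⟩ := Metric.mem_nhds_iff.1 hmem
  have hbsq : ∀ x ∈ Metric.ball p ρ, b x ^ 2 = Q.eval x := by
    intro x hx
    have hx0 : Q.eval x / Q.eval p ≠ 0 := Complex.slitPlane_ne_zero (hball hx)
    simp only [hb]
    rw [mul_pow, hs, ← Complex.exp_nat_mul]
    have : ((2 : ℕ) : ℂ) * (1 / 2 * Complex.log (Q.eval x / Q.eval p))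
        = Complex.log (Q.eval x / Q.eval p) := by push_cast; ring
    rw [this, Complex.exp_log hx0]
    field_simp
  have hbd : DifferentiableOn ℂ b (Metric.ball p ρ) := by
    intro x hx
    have h1 : DifferentiableAt ℂ (fun x => Q.eval x / Q.eval p) x :=
      Q.differentiable.differentiableAt.div_const _
    have h2 := h1.clog (hball hx)
    exact (((h2.const_mul (1 / 2)).cexp).const_mul s).differentiableWithinAt
  obtain ⟨B, hB0, hB⟩ := hbd.isExactOn_ball.with_val_at p 0
  have hb0 : ∀ x ∈ Metric.ball p ρ, b x ≠ 0 := by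
    intro x hx h
    have := hbsq x hx
    rw [h] at this
    have hx0 : Q.eval x / Q.eval p ≠ 0 := Complex.slitPlane_ne_zero (hball hx)
    apply hx0
    rw [← this]; simp
  obtain ⟨e, hpe, heU, heB⟩ := exists_partialHomeomorph Metric.isOpen_ball hB
    (Metric.mem_ball_self hρ) (hb0 p (Metric.mem_ball_self hρ))
  refine ⟨e, b, hpe, by rw [heB, hB0], fun x hx => ⟨?_, hbsq x (heU hx), hb0 x (heU hx)⟩⟩
  rw [heB]; exact hB x (heU hx)

/-- `γ` is a horizontal curve at `t`: `γ t` is not a turning point and `Q(γ) (γ')² = 1`. -/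
def IsHorizontalAt (Q : ℂ[X]) (γ : ℝ → ℂ) (t : ℝ) : Prop :=
  ¬ Q.IsRoot (γ t) ∧ ∃ v : ℂ, HasDerivAt γ v t ∧ Q.eval (γ t) * v ^ 2 = 1

/-- In a local coordinate `∫ √Q` at its end point, a horizontal curve is a real segment. -/
theorem horizontal_in_chart {Q : ℂ[X]} {e : OpenPartialHomeomorph ℂ ℂ} {b : ℂ → ℂ} {p : ℂ}
    (hpe : p ∈ e.source) (hp0 : e p = 0)
    (hb : ∀ x ∈ e.source, HasDerivAt e (b x) x ∧ b x ^ 2 = Q.eval x ∧ b x ≠ 0)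
    {γ : ℝ → ℂ} {β : ℝ} (hγ : Tendsto γ (𝓝[<] β) (𝓝 p))
    (hh : ∀ᶠ t in 𝓝[<] β, IsHorizontalAt Q γ t) :
    ∃ ε : ℝ, (ε = 1 ∨ ε = -1) ∧
      ∀ᶠ t in 𝓝[<] β, γ t ∈ e.source ∧ e (γ t) = ((ε * (t - β) : ℝ) : ℂ) := by
  have hev := hh.and (hγ (e.open_source.mem_nhds hpe))
  obtain ⟨α, hα, hsub⟩ := mem_nhdsLT_iff_exists_Ioo_subset.1 hev
  have hα : α < β := hα
  have hderiv : ∀ t ∈ Ioo α β, ∃ v : ℂ, HasDerivAt (fun s => e (γ s)) v t ∧ v ^ 2 = 1 := by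
    intro t ht
    obtain ⟨⟨-, v, hv, hQv⟩, hs⟩ := hsub ht
    obtain ⟨h1, h2, -⟩ := hb _ hs
    exact ⟨b (γ t) * v, h1.comp t hv, by rw [mul_pow, h2, hQv]⟩
  choose! v hv hv2 using hderiv
  have hv1 : ∀ t ∈ Ioo α β, v t = 1 ∨ v t = -1 := fun t ht => sq_eq_one_iff.1 (hv2 t ht)
  have hre : ∀ t ∈ Ioo α β, HasDerivWithinAt (fun s => (e (γ s)).re) (v t).re (Ioo α β) t := by
    intro t ht
    exact (Complex.reCLM.hasFDerivAt.comp_hasDerivAt t (hv t ht)).hasDerivWithinAt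
  have hne : ∀ t ∈ Ioo α β, (v t).re ≠ 0 := by
    intro t ht
    rcases hv1 t ht with h | h <;> rw [h] <;> simp
  -- Continuity of the derivative is not assumed; Darboux's theorem still excludes a change between
  -- 1 and -1, since 0 is not attained.
  obtain ⟨ε, hε, hvε⟩ : ∃ ε : ℝ, (ε = 1 ∨ ε = -1) ∧ ∀ t ∈ Ioo α β, v t = ε := by
    rcases hasDerivWithinAt_forall_lt_or_forall_gt_of_forall_ne (convex_Ioo α β) hre hne with h | h
    · refine ⟨-1, Or.inr rfl, fun t ht => ?_⟩
      rcases hv1 t ht with h1 | h1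
      · have := h t ht
        rw [h1] at this; norm_num at this
      · rw [h1]; simp
    · refine ⟨1, Or.inl rfl, fun t ht => ?_⟩
      rcases hv1 t ht with h1 | h1
      · rw [h1]; simp
      · have := h t ht
        rw [h1] at this; norm_num at this
  refine ⟨ε, hε, ?_⟩
  set F : ℝ → ℂ := fun t => e (γ t) - ((ε * (t - β) : ℝ) : ℂ) with hF
  have hFd : ∀ t ∈ Ioo α β, HasDerivAt F 0 t := by
    intro t ht
    have h1 := hv t ht
    rw [hvε t ht] at h1
    have h2 : HasDerivAt (fun t : ℝ => ((ε * (t - β) : ℝ) : ℂ)) ((ε * 1 : ℝ) : ℂ) t :=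
      (((hasDerivAt_id t).sub_const β).const_mul ε).ofReal_comp
    have := h1.sub h2
    rw [mul_one, sub_self] at this
    exact this
  have hFc : ∀ s ∈ Ioo α β, ∀ t ∈ Ioo α β, F s = F t := by
    intro s hs t ht
    exact isOpen_Ioo.is_const_of_deriv_eq_zero isPreconnected_Ioo
      (fun x hx => (hFd x hx).differentiableAt.differentiableWithinAt)
      (fun x hx => (hFd x hx).deriv) hs ht
  have hFlim : Tendsto F (𝓝[<] β) (𝓝 0) := by
    have h1 : Tendsto (fun t => e (γ t)) (𝓝[<] β) (𝓝 (e p)) :=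
      ((e.continuousAt hpe).tendsto).comp hγ
    have h2 : Tendsto (fun t : ℝ => ((ε * (t - β) : ℝ) : ℂ)) (𝓝[<] β)
        (𝓝 ((ε * (β - β) : ℝ) : ℂ)) :=
      (Continuous.tendsto (by fun_prop) β).mono_left nhdsWithin_le_nhds
    have := h1.sub h2
    rwa [hp0, sub_self, mul_zero, Complex.ofReal_zero, sub_zero] at this
  have hIoo : Ioo α β ∈ 𝓝[<] β := Ioo_mem_nhdsLT hα
  filter_upwards [hIoo] with t ht
  refine ⟨(hsub ht).2, ?_⟩
  have : F t = 0 := by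
    refine tendsto_nhds_unique (tendsto_const_nhds.congr' ?_) hFlim
    filter_upwards [hIoo] with s hs using hFc t ht s hs
  exact sub_eq_zero.1 this

/-- Concatenation of a Stokes curve with a horizontal curve run backwards. -/
theorem mem_stokesSet_of_concat {Q : ℂ[X]} {γ y : ℝ → ℂ} {p : ℂ} {T₁ T t₀ : ℝ} (hT₁ : 0 ≤ T₁)
    (hγ : ContinuousOn γ (Icc 0 T₁)) (hγ0 : Q.IsRoot (γ 0)) (hγT : γ T₁ = p)
    (hγh : ∀ t ∈ Ioo 0 T₁, IsHorizontalAt Q γ t) (ht₀ : t₀ < T)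
    (hy : Tendsto y (𝓝[<] T) (𝓝 p)) (hyh : ∀ t ∈ Ico t₀ T, IsHorizontalAt Q y t)
    (hjoin : T₁ = 0 ∨ IsHorizontalAt Q (fun t => if t ≤ T₁ then γ t else y (T - (t - T₁))) T₁) :
    y t₀ ∈ stokesSet Q := by
  set g : ℝ → ℂ := fun t => if t ≤ T₁ then γ t else y (T - (t - T₁)) with hg
  have hyc : ContinuousOn (fun t => Function.update y T p (T - (t - T₁)))
      (Icc T₁ (T₁ + (T - t₀))) := by
    have h1 : ContinuousOn (Function.update y T p) (Icc t₀ T) := by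
      rw [continuousOn_update_iff]
      have hd : Icc t₀ T \ {T} = Ico t₀ T := Icc_sdiff_right
      rw [hd]
      refine ⟨fun t ht => ?_, fun _ => hy.mono_left (nhdsWithin_mono _ Ico_subset_Iio_self)⟩
      obtain ⟨-, v, hv, -⟩ := hyh t ht
      exact hv.continuousAt.continuousWithinAt
    refine h1.comp (by fun_prop) (fun t ht => ⟨?_, ?_⟩)
    · linarith [ht.2]
    · linarith [ht.1]
  -- After `γ`, which takes time `T₁`, the curve `y` is run backwards from `p` to `y t₀`. Only
  -- interior times are tested, so for `T₁ = 0` the junction, then a turning point, needs no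
  -- differentiability.
  refine ⟨g, T₁ + (T - t₀), by linarith, ?_, by simpa [hg, hT₁] using hγ0, ?_, ?_⟩
  · have hu : Icc 0 (T₁ + (T - t₀)) = Icc 0 T₁ ∪ Icc T₁ (T₁ + (T - t₀)) :=
      (Icc_union_Icc_eq_Icc hT₁ (by linarith)).symm
    rw [hu]
    refine ContinuousOn.union_of_isClosed ?_ ?_ isClosed_Icc isClosed_Icc
    · exact hγ.congr (fun t ht => by simp [hg, ht.2])
    · refine hyc.congr (fun t ht => ?_)
      rcases ht.1.eq_or_lt with h | h
      · simp [hg, ← h, hγT]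
      · simp only [hg]
        rw [if_neg (not_le.2 h), Function.update_of_ne (by linarith)]
  · simp only [hg]
    rw [if_neg (by linarith)]
    congr 1; ring
  · intro t ht
    change IsHorizontalAt Q g t
    rcases lt_trichotomy t T₁ with h | h | h
    · obtain ⟨h1, v, hv, hQ⟩ := hγh t ⟨ht.1, h⟩
      have hgt : g t = γ t := by simp [hg, h.le]
      refine ⟨by rwa [hgt], v, hv.congr_of_eventuallyEq ?_, by rwa [hgt]⟩
      filter_upwards [Iio_mem_nhds h] with s hs
      have hs : s < T₁ := hs
      simp [hg, hs.le]
    · subst h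
      rcases hjoin with h0 | h0
      · exact absurd ht.1 (by rw [h0]; exact lt_irrefl _)
      · exact h0
    · have hmem : T - (t - T₁) ∈ Ico t₀ T := ⟨by linarith [ht.2], by linarith⟩
      obtain ⟨h1, v, hv, hQ⟩ := hyh _ hmem
      have hgt : g t = y (T - (t - T₁)) := by simp [hg, not_le.2 h]
      refine ⟨by rwa [hgt], -v, ?_, by rw [hgt, neg_sq]; exact hQ⟩
      have h2 : HasDerivAt (fun t : ℝ => T - (t - T₁)) (-1) t := by
        simpa using ((hasDerivAt_id t).sub_const T₁).const_sub T
      have h3 : HasDerivAt (fun t : ℝ => y (T - (t - T₁))) (-v) t := by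
        have := HasDerivAt.scomp t hv h2
        rw [neg_one_smul] at this
        exact this
      refine h3.congr_of_eventuallyEq ?_
      filter_upwards [Ioi_mem_nhds h] with s hs
      simp only [hg]
      rw [if_neg (not_le.2 hs)]

/-- A horizontal curve that converges to a point of the Stokes set is contained in the Stokes set
near its end. -/
theorem eventually_mem_stokesSet {Q : ℂ[X]} {y : ℝ → ℂ} {p : ℂ} {T : ℝ} (hp : p ∈ stokesSet Q)
    (hy : Tendsto y (𝓝[<] T) (𝓝 p)) (hyh : ∀ᶠ t in 𝓝[<] T, IsHorizontalAt Q y t) :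
    ∀ᶠ t in 𝓝[<] T, y t ∈ stokesSet Q := by
  obtain ⟨α₀, hα₀, hsub₀⟩ := mem_nhdsLT_iff_exists_Ioo_subset.1 hyh
  -- If `p` is a turning point, `y` run backwards is itself a Stokes curve emanating from `p`.
  by_cases hroot : Q.IsRoot p
  · filter_upwards [Ioo_mem_nhdsLT hα₀] with t ht
    exact mem_stokesSet_of_concat (γ := fun _ => p) le_rfl continuousOn_const hroot rfl
      (fun s hs => absurd (hs.1.trans hs.2) (lt_irrefl _)) ht.2 hy
      (fun s hs => hsub₀ ⟨ht.1.trans_le hs.1, hs.2⟩) (Or.inl rfl)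
  obtain ⟨γ, T₁, hT₁, hγ, hγ0, hγT, hγh⟩ := hp
  change ∀ t ∈ Ioo 0 T₁, IsHorizontalAt Q γ t at hγh
  have hT₁pos : 0 < T₁ := by
    refine hT₁.lt_of_ne fun h => hroot ?_
    rw [← hγT, ← h]; exact hγ0
  obtain ⟨e, b, hpe, hp0, hb⟩ := exists_chart Q hroot
  have hγlim : Tendsto γ (𝓝[<] T₁) (𝓝 p) := by
    have := hγ T₁ ⟨hT₁, le_rfl⟩
    rw [ContinuousWithinAt, hγT] at this
    refine this.mono_left ?_
    rw [← nhdsWithin_Ioo_eq_nhdsLT hT₁pos]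
    exact nhdsWithin_mono _ Ioo_subset_Icc_self
  obtain ⟨ε₁, hε₁, hev₁⟩ := horizontal_in_chart hpe hp0 hb hγlim
    (by filter_upwards [Ioo_mem_nhdsLT hT₁pos] with t ht using hγh t ht)
  obtain ⟨ε₂, hε₂, hev₂⟩ := horizontal_in_chart hpe hp0 hb hy hyh
  obtain ⟨α₁, hα₁, hsub₁⟩ := mem_nhdsLT_iff_exists_Ioo_subset.1
    (inter_mem hev₁ (Ioo_mem_nhdsLT hT₁pos))
  obtain ⟨α₂, hα₂, hsub₂⟩ := mem_nhdsLT_iff_exists_Ioo_subset.1 (inter_mem hev₂ hyh)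
  have hα₁ : α₁ < T₁ := hα₁
  have hα₂ : α₂ < T := hα₂
  have hshift : ∀ᶠ t in 𝓝[<] T, t ∈ Ioo α₂ T ∧ t - T + T₁ ∈ Ioo α₁ T₁ := by
    filter_upwards [Ioo_mem_nhdsLT (max_lt hα₂ (show T - (T₁ - α₁) < T by linarith))] with t ht
    have h1 := (le_max_left _ _).trans_lt ht.1
    have h2 := (le_max_right _ _).trans_lt ht.1
    exact ⟨⟨h1, ht.2⟩, by linarith, by linarith [ht.2]⟩
  -- In the chart at `p` both curves are real segments ending at 0. If they arrive from the same
  -- side, `y` coincides with the last piece of `γ`.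
  by_cases hεε : ε₁ = ε₂
  · filter_upwards [hshift] with t ht
    obtain ⟨hs2, he2⟩ := (hsub₂ ht.1).1
    obtain ⟨⟨hs1, he1⟩, hI⟩ := hsub₁ ht.2
    have : γ (t - T + T₁) = y t := by
      refine e.injOn hs1 hs2 ?_
      rw [he1, he2, hεε]
      congr 2; ring
    rw [← this]
    exact ⟨γ, t - T + T₁, hI.1.le, hγ.mono (Icc_subset_Icc_right hI.2.le), hγ0, rfl,
      fun s hs => hγh s ⟨hs.1, hs.2.trans hI.2⟩⟩
  -- If they arrive from opposite sides, the reversed `y` continues `γ` through `p` along one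
  -- straight segment, so the concatenation is horizontal at the junction.
  have hopp : ε₂ = -ε₁ := by
    rcases hε₁ with rfl | rfl <;> rcases hε₂ with rfl | rfl <;>
      first | exact absurd rfl hεε | norm_num
  filter_upwards [Ioo_mem_nhdsLT hα₂] with t₀ ht₀
  refine mem_stokesSet_of_concat hT₁ hγ hγ0 hγT hγh ht₀.2 hy
    (fun t ht => (hsub₂ ⟨ht₀.1.trans_le ht.1, ht.2⟩).2) (Or.inr ?_)
  set g : ℝ → ℂ := fun t => if t ≤ T₁ then γ t else y (T - (t - T₁)) with hg
  have hgT : g T₁ = p := by simp [hg, hγT]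
  have hloc : ∀ᶠ t in 𝓝 T₁, g t ∈ e.source ∧ e (g t) = ((ε₁ * (t - T₁) : ℝ) : ℂ) := by
    filter_upwards [Ioo_mem_nhds hα₁ (show T₁ < T₁ + (T - α₂) by linarith)] with t ht
    rcases lt_trichotomy t T₁ with h | h | h
    · have : g t = γ t := by simp [hg, h.le]
      rw [this]
      exact (hsub₁ ⟨ht.1, h⟩).1
    · rw [h, hgT]
      exact ⟨hpe, by simp [hp0]⟩
    · have : g t = y (T - (t - T₁)) := by simp [hg, not_le.2 h]
      rw [this]
      obtain ⟨h1, h2⟩ := (@hsub₂ (T - (t - T₁)) ⟨by linarith [ht.2], by linarith⟩).1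
      refine ⟨h1, ?_⟩
      rw [h2, hopp]; congr 1; ring
  have hgcont : ContinuousAt g T₁ := by
    have h1 : ContinuousAt (fun t : ℝ => e.symm ((ε₁ * (t - T₁) : ℝ) : ℂ)) T₁ := by
      refine ContinuousAt.comp (g := e.symm) ?_ (by fun_prop)
      refine e.continuousAt_symm ?_
      rw [sub_self, mul_zero, Complex.ofReal_zero, ← hp0]
      exact e.map_source hpe
    refine h1.congr ?_
    filter_upwards [hloc] with t ht
    rw [← ht.2, e.left_inv ht.1]
  refine ⟨by rw [hgT]; exact hroot, _, hasDerivAt_lift e.open_source (fun x hx => (hb x hx).1)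
    (c := fun t : ℝ => ((ε₁ * (t - T₁) : ℝ) : ℂ)) (c' := ((ε₁ * 1 : ℝ) : ℂ)) hgcont
    (by rw [hgT]; exact hpe) (by rw [hgT]; exact (hb p hpe).2.2)
    (((hasDerivAt_id T₁).sub_const T₁).const_mul ε₁).ofReal_comp
    (hloc.mono fun t ht => ht.2), ?_⟩
  rw [hgT, mul_pow, inv_pow, (hb p hpe).2.1, ← mul_assoc, mul_inv_cancel₀ hroot]
  rcases hε₁ with h1 | h1 <;> rw [h1] <;> simp

end Charts


/-! ### Completeness of the horizontal flow on a Stokes domain -/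

section Completeness

theorem mem_stokesSet_of_isRoot {Q : ℂ[X]} {x : ℂ} (hx : Q.IsRoot x) : x ∈ stokesSet Q :=
  ⟨fun _ => x, 0, le_rfl, continuousOn_const, hx, rfl,
    fun _ ht => absurd (ht.1.trans ht.2) (lt_irrefl _)⟩

theorem IsStokesDomain.subset_compl {Q : ℂ[X]} {Ω : Set ℂ} (hΩ : IsStokesDomain Q Ω) :
    Ω ⊆ (stokesSet Q)ᶜ := by
  obtain ⟨-, x, -, rfl⟩ := hΩ
  exact connectedComponentIn_subset _ _

theorem IsStokesDomain.isPreconnected {Q : ℂ[X]} {Ω : Set ℂ} (hΩ : IsStokesDomain Q Ω) :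
    IsPreconnected Ω := by
  obtain ⟨-, x, -, rfl⟩ := hΩ
  exact isPreconnected_connectedComponentIn

theorem IsStokesDomain.not_isRoot {Q : ℂ[X]} {Ω : Set ℂ} (hΩ : IsStokesDomain Q Ω) {x : ℂ}
    (hx : x ∈ Ω) : ¬ Q.IsRoot x :=
  fun h => hΩ.subset_compl hx (mem_stokesSet_of_isRoot h)

theorem IsStokesDomain.branch_ne_zero {Q : ℂ[X]} {Ω : Set ℂ} (hΩ : IsStokesDomain Q Ω)
    {r : ℂ → ℂ} (hr : IsSqrtBranch Q Ω r) {x : ℂ} (hx : x ∈ Ω) : r x ≠ 0 := by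
  intro h
  have := hr.2 x hx
  rw [h] at this
  exact hΩ.not_isRoot hx (by rw [Polynomial.IsRoot, ← this]; simp)

theorem IsStokesDomain.mem_of_isPreconnected {Q : ℂ[X]} {Ω : Set ℂ} (hΩ : IsStokesDomain Q Ω)
    {s : Set ℂ} (hs : IsPreconnected s) (hsub : s ⊆ (stokesSet Q)ᶜ) {x : ℂ} (hxs : x ∈ s)
    (hx : x ∈ Ω) : s ⊆ Ω := by
  obtain ⟨-, x₀, -, rfl⟩ := hΩ
  rw [connectedComponentIn_eq hx]
  exact hs.subset_connectedComponentIn hxs hsub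

/-- Beyond `R` a curve with `Q(γ) (γ')² = 1` has speed below 1, so it cannot reach infinity in
finite time. It also confines the zeros of `Q`. -/
theorem exists_one_lt_norm_eval {Q : ℂ[X]} (hQ : 0 < Q.degree) :
    ∃ R : ℝ, ∀ x : ℂ, R ≤ ‖x‖ → 1 < ‖Q.eval x‖ := by
  have h := Q.tendsto_norm_atTop hQ (tendsto_norm_cocompact_atTop (E := ℂ))
  have h1 := h.eventually_gt_atTop 1
  rw [Metric.cobounded_eq_cocompact.symm] at h1
  obtain ⟨R, -, hR⟩ := (Metric.hasBasis_cobounded_compl_closedBall (0 : ℂ)).mem_iff.1 h1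
  refine ⟨R + 1, fun x hx => hR ?_⟩
  simp only [mem_compl_iff, Metric.mem_closedBall, dist_zero_right, not_le]
  linarith

theorem norm_sq_of_mul_sq_eq_one {q v : ℂ} (h : q * v ^ 2 = 1) : ‖q‖ * ‖v‖ ^ 2 = 1 := by
  have := congrArg norm h
  rwa [norm_mul, norm_pow, norm_one] at this

/-- A horizontal curve stays bounded in finite time. -/
theorem horizontal_bounded {Q : ℂ[X]} (hQ : 0 < Q.degree) {y : ℝ → ℂ} {α β : ℝ}
    (hyh : ∀ t ∈ Ico α β, IsHorizontalAt Q y t) : ∃ M : ℝ, ∀ t ∈ Ico α β, ‖y t‖ ≤ M := by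
  obtain ⟨R, hR⟩ := exists_one_lt_norm_eval hQ
  refine ⟨max ‖y α‖ R + (β - α), fun t ht => ?_⟩
  have hd : ∀ s ∈ Ico α β, HasDerivAt y (deriv y s) s ∧ Q.eval (y s) * deriv y s ^ 2 = 1 := by
    intro s hs
    obtain ⟨-, v, hv, hQv⟩ := hyh s hs
    exact ⟨by rw [hv.deriv]; exact hv, by rw [hv.deriv]; exact hQv⟩
  have hsub : ∀ s ∈ Icc α t, s ∈ Ico α β := fun s hs => ⟨hs.1, hs.2.trans_lt ht.2⟩
  have := image_norm_le_of_norm_deriv_right_lt_deriv_boundary' (f := y) (f' := deriv y)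
    (a := α) (b := t) (B := fun s => max ‖y α‖ R + (s - α)) (B' := fun _ => 1)
    (fun s hs => (hd s (hsub s hs)).1.continuousAt.continuousWithinAt)
    (fun s hs => (hd s (hsub s ⟨hs.1, hs.2.le⟩)).1.hasDerivWithinAt)
    (by simp) (by fun_prop)
    (fun s _ => (((hasDerivAt_id s).sub_const α).const_add _).hasDerivWithinAt)
    (fun s hs h => by
      have h1 : R ≤ ‖y s‖ := by
        rw [h]
        linarith [le_max_right ‖y α‖ R, hs.1]
      have h2 := hR _ h1
      have h3 := norm_sq_of_mul_sq_eq_one (hd s (hsub s ⟨hs.1, hs.2.le⟩)).2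
      by_contra! hc
      nlinarith [norm_nonneg (deriv y s), sq_nonneg (‖deriv y s‖ - 1)])
    (x := t) ⟨ht.1, le_rfl⟩
  refine this.trans ?_
  linarith [ht.2]

/-- A horizontal curve converges in finite time. -/
theorem horizontal_tendsto {Q : ℂ[X]} (hQ : 0 < Q.degree) {y : ℝ → ℂ} {α β : ℝ} (hαβ : α < β)
    (hyh : ∀ t ∈ Ico α β, IsHorizontalAt Q y t) : ∃ p, Tendsto y (𝓝[<] β) (𝓝 p) := by
  obtain ⟨M, hM⟩ := horizontal_bounded hQ hyh
  -- A primitive of `Q` rather than of `√Q` is entire and needs no branch. Along `y` its derivative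
  -- has modulus `|Q|^(1/2)`, which is bounded, so `F ∘ y` has a limit `L`.
  obtain ⟨F, hF⟩ := Q.differentiable.isExactOn_univ
  have hF : ∀ z, HasDerivAt F (Q.eval z) z := fun z => hF z (mem_univ z)
  have hFdiff : Differentiable ℂ F := fun z => (hF z).differentiableAt
  have hIco : Ico α β ∈ 𝓝[<] β := Ico_mem_nhdsLT hαβ
  have hycont : ContinuousOn y (Ico α β) := by
    intro t ht
    obtain ⟨-, v, hv, -⟩ := hyh t ht
    exact hv.continuousAt.continuousWithinAt
  obtain ⟨K, hK⟩ := (isCompact_closedBall (0 : ℂ) M).exists_bound_of_continuousOn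
    Q.continuous.continuousOn
  have hlip : LipschitzOnWith (Real.toNNReal (Real.sqrt K)) (fun t => F (y t)) (Ico α β) := by
    have hd : ∀ t ∈ Ico α β, HasDerivAt (fun t => F (y t)) (Q.eval (y t) * deriv y t) t ∧
        ‖Q.eval (y t) * deriv y t‖ ≤ Real.sqrt K := by
      intro t ht
      obtain ⟨-, v, hv, hQv⟩ := hyh t ht
      rw [hv.deriv]
      refine ⟨(hF (y t)).comp t hv, Real.le_sqrt_of_sq_le ?_⟩
      have h1 := norm_sq_of_mul_sq_eq_one hQv
      have h2 := hK (y t) (by simpa using hM t ht)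
      rw [norm_mul, mul_pow]
      calc ‖Q.eval (y t)‖ ^ 2 * ‖v‖ ^ 2 = ‖Q.eval (y t)‖ * (‖Q.eval (y t)‖ * ‖v‖ ^ 2) := by ring
        _ ≤ K := by rw [h1, mul_one]; exact h2
    refine (convex_Ico α β).lipschitzOnWith_of_nnnorm_hasDerivWithin_le
      (fun t ht => (hd t ht).1.hasDerivWithinAt) (fun t ht => ?_)
    rw [← NNReal.coe_le_coe, coe_nnnorm, Real.coe_toNNReal _ (Real.sqrt_nonneg _)]
    exact (hd t ht).2
  have hcau : Cauchy (map (fun t => F (y t)) (𝓝[<] β)) :=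
    (cauchy_nhds.mono nhdsWithin_le_nhds).map_of_le hlip.uniformContinuousOn
      (le_principal_iff.2 hIco)
  obtain ⟨L, hL⟩ := CompleteSpace.complete hcau
  have hL : Tendsto (fun t => F (y t)) (𝓝[<] β) (𝓝 L) := hL
  obtain ⟨p, -, hp⟩ := (isCompact_closedBall (0 : ℂ) M).exists_clusterPt
    (f := map y (𝓝[<] β)) (le_principal_iff.2 (mem_map.2
      (mem_of_superset hIco fun t ht => by simpa using hM t ht)))
  have hp : MapClusterPt p (𝓝[<] β) y := hp
  have hFp : F p = L := by
    obtain ⟨U, hU, hyU⟩ := mapClusterPt_iff_ultrafilter.1 hp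
    exact tendsto_nhds_unique ((hFdiff.continuous.tendsto p).comp hyU) (hL.mono_left hU)
  have hQ0 : Q ≠ 0 := by rintro rfl; simp at hQ
  have hiso : ∀ᶠ z in 𝓝[≠] p, F z ≠ L := by
    rcases (hFdiff.analyticAt p).eventually_eq_or_eventually_ne (analyticAt_const (v := L))
      with h | h
    · exfalso
      have h1 : ∀ᶠ z in 𝓝 p, Q.IsRoot z := by
        filter_upwards [h.eventually_nhds] with z hz
        have : HasDerivAt F 0 z := (hasDerivAt_const z L).congr_of_eventuallyEq hz
        exact (hF z).unique this
      exact infinite_of_mem_nhds p h1 ((Q.rootSet_finite ℂ).subset (fun z hz => by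
        rw [mem_rootSet]
        exact ⟨hQ0, by simpa using hz⟩))
    · exact h
  refine ⟨p, Metric.tendsto_nhds.2 fun ε hε => ?_⟩
  obtain ⟨ε₀, hε₀, hball⟩ := Metric.mem_nhdsWithin_iff.1 hiso
  -- The cluster point `p` is an isolated solution of `F = L`, so `F` avoids `L` on a small circle
  -- around `p`. Eventually `y` cannot cross that circle; being inside it at some late time, it
  -- stays inside.
  set η := min (ε / 2) (ε₀ / 2) with hη
  have hηpos : 0 < η := by positivity
  have hsph : L ∉ F '' Metric.sphere p η := by
    rintro ⟨z, hz, hzL⟩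
    refine hball ⟨?_, ?_⟩ hzL
    · rw [Metric.mem_ball, Metric.mem_sphere.1 hz]
      exact (min_le_right _ _).trans_lt (by linarith)
    · rintro rfl
      rw [Metric.mem_sphere, dist_self] at hz
      exact hηpos.ne hz
  have hclosed : IsClosed (F '' Metric.sphere p η) :=
    ((isCompact_sphere p η).image hFdiff.continuous).isClosed
  have hev : ∀ᶠ t in 𝓝[<] β, y t ∉ Metric.sphere p η := by
    filter_upwards [hL (hclosed.isOpen_compl.mem_nhds hsph)] with t ht hts
    exact ht ⟨_, hts, rfl⟩
  obtain ⟨α', hα', hsub⟩ := mem_nhdsLT_iff_exists_Ioo_subset.1 (inter_mem hev hIco)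
  have hIoo : Ioo α' β ∈ 𝓝[<] β := Ioo_mem_nhdsLT hα'
  obtain ⟨t₁, ht₁p, ht₁⟩ := ((mapClusterPt_iff_frequently.1 hp _
    (Metric.ball_mem_nhds p hηpos)).and_eventually hIoo).exists
  filter_upwards [hIoo] with t ht
  have hlt : dist (y t) p < η := by
    by_contra! hge
    obtain ⟨s, hs, hse⟩ := (isPreconnected_Ioo (a := α') (b := β)).intermediate_value ht₁ ht
      (f := fun t => dist (y t) p)
      ((continuous_id.dist continuous_const).comp_continuousOn
        (hycont.mono fun s hs => (hsub hs).2))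
      ⟨le_of_lt (Metric.mem_ball.1 ht₁p), hge⟩
    exact (hsub hs).1 hse
  exact hlt.trans_le ((min_le_left _ _).trans (by linarith))

/-- A branch of `∫ √Q` is a local homeomorphism on a Stokes domain. -/
theorem IsStokesDomain.isLocalHomeomorph {Q : ℂ[X]} {Ω : Set ℂ} (hΩ : IsStokesDomain Q Ω)
    {r A : ℂ → ℂ} (hr : IsSqrtBranch Q Ω r) (hA : ∀ x ∈ Ω, HasDerivAt A (r x) x) :
    IsLocalHomeomorph (fun x : Ω => A x) := by
  have h1 : IsLocalHomeomorphOn A Ω := by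
    refine IsLocalHomeomorphOn.mk _ _ fun x hx => ?_
    obtain ⟨e, hxe, -, heA⟩ := exists_partialHomeomorph hΩ.1 hA hx (hΩ.branch_ne_zero hr hx)
    exact ⟨e, hxe, fun z _ => by rw [heA]⟩
  have h2 : IsLocalHomeomorph (Subtype.val : Ω → ℂ) :=
    hΩ.1.isOpenEmbedding_subtypeVal.isLocalHomeomorph
  rw [isLocalHomeomorph_iff_isLocalHomeomorphOn_univ] at h2 ⊢
  exact h1.comp h2 (fun x _ => x.2)

/-- Forward completeness of the horizontal flow on a Stokes domain. -/
theorem IsStokesDomain.exists_forward_lift {Q : ℂ[X]} {Ω : Set ℂ} (hΩ : IsStokesDomain Q Ω)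
    (hQ : 0 < Q.degree) {r A : ℂ → ℂ} (hr : IsSqrtBranch Q Ω r)
    (hA : ∀ x ∈ Ω, HasDerivAt A (r x) x) (x : Ω) :
    ∃ y : ℝ → Ω, ContinuousOn y (Ici 0) ∧ y 0 = x ∧
      ∀ t ∈ Ici (0 : ℝ), A (y t) = A x + t := by
  have hf := hΩ.isLocalHomeomorph hr hA
  refine exists_lift_Ici hf (c := fun t : ℝ => A x + t) (by fun_prop) (by simp) ?_
  intro T hT y hy hy0 hyf
  have hhor : ∀ t ∈ Ioo 0 T, IsHorizontalAt Q (fun t => (y t : ℂ)) t := by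
    intro t ht
    have hne := hΩ.branch_ne_zero hr (y t).2
    refine ⟨hΩ.not_isRoot (y t).2, _, hasDerivAt_lift hΩ.1 hA (y := fun t => (y t : ℂ))
      (c := fun t : ℝ => A x + t) (c' := 1) ?_ (y t).2 hne ?_ ?_, ?_⟩
    · exact continuous_subtype_val.continuousAt.comp
        ((hy t ⟨ht.1.le, ht.2⟩).continuousAt (Ico_mem_nhds ht.1 ht.2))
    · simpa using (hasDerivAt_id t).ofReal_comp.const_add (A x)
    · filter_upwards [Ico_mem_nhds ht.1 ht.2] with s hs using hyf s hs
    · have := hr.2 _ (y t).2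
      rw [mul_one, inv_pow, this, mul_inv_cancel₀]
      exact hΩ.not_isRoot (y t).2
  obtain ⟨p, hp⟩ := horizontal_tendsto hQ (α := T / 2) (β := T) (by linarith)
    (fun t ht => hhor t ⟨by linarith [ht.1], ht.2⟩)
  have hpS : p ∉ stokesSet Q := by
    intro hpS
    have h1 := eventually_mem_stokesSet hpS hp
      (by filter_upwards [Ioo_mem_nhdsLT hT] with t ht using hhor t ht)
    obtain ⟨t, ht⟩ := h1.exists
    exact hΩ.subset_compl (y t).2 ht
  -- The trajectory together with its limit is a connected set disjoint from the Stokes set.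
  have hpΩ : p ∈ Ω := by
    set s : Set ℂ := (fun t => (y t : ℂ)) '' Ico 0 T with hs
    have hsc : IsPreconnected s :=
      isPreconnected_Ico.image _ (continuous_subtype_val.comp_continuousOn hy)
    have hpc : p ∈ closure s := by
      refine mem_closure_of_tendsto hp ?_
      filter_upwards [Ico_mem_nhdsLT hT] with t ht using mem_image_of_mem _ ht
    have hsc' : IsPreconnected (insert p s) :=
      hsc.subset_closure (subset_insert _ _) (insert_subset hpc subset_closure)
    refine hΩ.mem_of_isPreconnected hsc' ?_ (x := y 0) (Or.inr ⟨0, ⟨le_rfl, hT⟩, rfl⟩) (y 0).2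
      (mem_insert _ _)
    rintro z (rfl | ⟨t, -, rfl⟩)
    · exact hpS
    · exact hΩ.subset_compl (y t).2
  exact ⟨⟨p, hpΩ⟩, tendsto_subtype_rng.2 hp⟩

/-- Completeness of the horizontal flow on a Stokes domain. -/
theorem IsStokesDomain.exists_lift {Q : ℂ[X]} {Ω : Set ℂ} (hΩ : IsStokesDomain Q Ω)
    (hQ : 0 < Q.degree) {r A : ℂ → ℂ} (hr : IsSqrtBranch Q Ω r)
    (hA : ∀ x ∈ Ω, HasDerivAt A (r x) x) (x : Ω) :
    ∃ y : ℝ → Ω, Continuous y ∧ y 0 = x ∧ ∀ t : ℝ, A (y t) = A x + t := by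
  obtain ⟨y₁, h₁c, h₁0, h₁A⟩ := hΩ.exists_forward_lift hQ hr hA x
  -- Backward time is forward time for the opposite branch, with integral `-A`.
  have hr' : IsSqrtBranch Q Ω (fun x => -r x) :=
    ⟨hr.1.neg, fun x hx => by rw [neg_sq]; exact hr.2 x hx⟩
  obtain ⟨y₂, h₂c, h₂0, h₂A⟩ := hΩ.exists_forward_lift hQ hr' (A := fun x => -A x)
    (fun x hx => (hA x hx).neg) x
  refine ⟨fun t => if t ≤ 0 then y₂ (-t) else y₁ t, ?_, by simp [h₂0], fun t => ?_⟩
  · rw [← continuousOn_univ, ← Iic_union_Ici (a := (0 : ℝ))]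
    refine ContinuousOn.union_of_isClosed ?_ ?_ isClosed_Iic isClosed_Ici
    · refine (h₂c.comp (f := fun t : ℝ => -t) (by fun_prop) (fun t ht => ?_)).congr
        (fun t ht => ?_)
      · simpa using ht
      · have ht : t ≤ 0 := ht
        simp [ht]
    · refine h₁c.congr fun t ht => ?_
      have ht : 0 ≤ t := ht
      rcases ht.eq_or_lt with h | h
      · simp [← h, h₁0, h₂0]
      · simp [not_le.2 h]
  · by_cases ht : t ≤ 0
    · have h := h₂A (-t) (by simpa using ht)
      simp only [ht, if_true]
      push_cast at h
      linear_combination -h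
    · simp only [ht, if_false]
      exact h₁A t (le_of_lt (not_le.1 ht))

theorem IsStokesDomain.injOn {Q : ℂ[X]} {Ω : Set ℂ} (hΩ : IsStokesDomain Q Ω)
    (hQ : 0 < Q.degree) {r A : ℂ → ℂ} (hr : IsSqrtBranch Q Ω r)
    (hA : ∀ x ∈ Ω, HasDerivAt A (r x) x) : InjOn A Ω := by
  have : PreconnectedSpace Ω := Subtype.preconnectedSpace hΩ.isPreconnected
  have h := injective_of_complete (hΩ.isLocalHomeomorph hr hA)
    (fun x => hΩ.exists_lift hQ hr hA x)
  intro x hx y hy hxy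
  exact congrArg Subtype.val (@h ⟨x, hx⟩ ⟨y, hy⟩ hxy)

end Completeness


/-! ### The conformal map onto a strip and the distance to the turning points -/

section StripCharts

/-- The strip `δ < Im z < μ - δ`. -/
def strip (μ : EReal) (δ : ℝ) : Set ℂ :=
  {z | δ < z.im ∧ ((z.im + δ : ℝ) : EReal) < μ}

theorem strip_mem_of_norm_sub_le {μ : EReal} {δ δ' ε : ℝ} (h : δ' + ε ≤ δ) {z w : ℂ}
    (hz : z ∈ strip μ δ) (hw : ‖w - z‖ ≤ ε) : w ∈ strip μ δ' := by
  have h1 := (Complex.abs_im_le_norm (w - z)).trans hw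
  rw [Complex.sub_im, abs_le] at h1
  refine ⟨by linarith [hz.1], lt_of_le_of_lt ?_ hz.2⟩
  exact EReal.coe_le_coe_iff.2 (by linarith)

theorem strip_subset {μ : EReal} {δ δ' : ℝ} (h : δ' ≤ δ) : strip μ δ ⊆ strip μ δ' :=
  fun z hz => strip_mem_of_norm_sub_le (ε := 0) (by linarith) hz (by simp)

theorem isOpen_strip (μ : EReal) (δ : ℝ) : IsOpen (strip μ δ) := by
  refine (isOpen_lt continuous_const Complex.continuous_im).inter ?_
  exact isOpen_lt (continuous_coe_real_ereal.comp (by fun_prop)) continuous_const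

theorem add_real_mem_strip {μ : EReal} {δ : ℝ} {z : ℂ} (t : ℝ) :
    z + t ∈ strip μ δ ↔ z ∈ strip μ δ := by
  simp [strip]

/-- `A` maps `Ω` conformally onto a horizontal strip with inverse `G`; `√Q` and `Q'/Q` satisfy
the bounds that hold away from the turning points. -/
structure IsStripChart (Q : ℂ[X]) (Ω : Set ℂ) (r A : ℂ → ℂ) (μ : EReal) (G : ℂ → ℂ) : Prop where
  isOpen : IsOpen Ω
  branch : IsSqrtBranch Q Ω r
  ne_zero : ∀ x ∈ Ω, r x ≠ 0
  hasDerivAt : ∀ x ∈ Ω, HasDerivAt A (r x) x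
  mapsTo : ∀ x ∈ Ω, A x ∈ strip μ 0
  inv_mem : ∀ z ∈ strip μ 0, G z ∈ Ω
  right_inv : ∀ z ∈ strip μ 0, A (G z) = z
  left_inv : ∀ x ∈ Ω, G (A x) = x
  inv_bound : ∀ δ : ℝ, 0 < δ → ∃ κ : ℝ, ∀ x ∈ Ω, A x ∈ strip μ δ → ‖(r x)⁻¹‖ ≤ κ
  logDeriv_bound : ∀ δ : ℝ, 0 < δ → ∃ M : ℝ, ∀ x ∈ Ω, A x ∈ strip μ δ →
    ‖Q.derivative.eval x / (4 * Q.eval x)‖ ≤ M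

theorem hasDerivAt_inverse {Ω : Set ℂ} {r A G : ℂ → ℂ} {μ : EReal} (hΩ : IsOpen Ω)
    (hr : ∀ x ∈ Ω, r x ≠ 0) (hA : ∀ x ∈ Ω, HasDerivAt A (r x) x)
    (hG : ∀ z ∈ strip μ 0, G z ∈ Ω) (hAG : ∀ z ∈ strip μ 0, A (G z) = z)
    (hGA : ∀ x ∈ Ω, G (A x) = x) {z : ℂ} (hz : z ∈ strip μ 0) :
    HasDerivAt G (r (G z))⁻¹ z := by
  obtain ⟨e, hpe, heΩ, heA⟩ := exists_partialHomeomorph hΩ hA (hG z hz) (hr _ (hG z hz))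
  have hez : e (G z) = z := by rw [heA, hAG z hz]
  have hzt : z ∈ e.target := by
    have := e.map_source hpe
    rwa [hez] at this
  have hsz : e.symm z = G z := by
    have := e.left_inv hpe
    rwa [hez] at this
  have h1 : HasDerivAt e.symm (r (G z))⁻¹ z := by
    refine e.hasDerivAt_symm hzt (hr _ (hG z hz)) ?_
    rw [hsz, heA]
    exact hA _ (hG z hz)
  refine h1.congr_of_eventuallyEq ?_
  filter_upwards [e.open_target.mem_nhds hzt] with w hw
  have h2 := hGA _ (heΩ (e.map_target hw))
  rwa [← heA, e.right_inv hw] at h2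

theorem IsStripChart.hasDerivAt_inv {Q : ℂ[X]} {Ω : Set ℂ} {r A G : ℂ → ℂ} {μ : EReal}
    (h : IsStripChart Q Ω r A μ G) {z : ℂ} (hz : z ∈ strip μ 0) :
    HasDerivAt G (r (G z))⁻¹ z :=
  hasDerivAt_inverse h.isOpen h.ne_zero h.hasDerivAt h.inv_mem h.right_inv h.left_inv hz

theorem norm_branch {Q : ℂ[X]} {Ω : Set ℂ} {r : ℂ → ℂ} (hr : IsSqrtBranch Q Ω r) {x : ℂ}
    (hx : x ∈ Ω) : ‖r x‖ = Real.sqrt ‖Q.eval x‖ := by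
  rw [← hr.2 x hx, norm_pow, Real.sqrt_sq (norm_nonneg _)]

/-- The points of `Ω` whose height has distance at least `δ` from the boundary heights
stay away from the turning points. -/
theorem exists_dist_root_bound {Q : ℂ[X]} (hQ : 0 < Q.degree) {Ω : Set ℂ} {r A G : ℂ → ℂ}
    {μ : EReal} (hΩ : IsOpen Ω) (hΩQ : ∀ x ∈ Ω, ¬ Q.IsRoot x) (hr : IsSqrtBranch Q Ω r)
    (hA : ∀ x ∈ Ω, HasDerivAt A (r x) x) (hG : ∀ z ∈ strip μ 0, G z ∈ Ω)
    (hGc : ContinuousOn G (strip μ 0)) (hGA : ∀ x ∈ Ω, G (A x) = x) {δ : ℝ} (hδ : 0 < δ) :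
    ∃ η : ℝ, 0 < η ∧ ∀ x ∈ Ω, A x ∈ strip μ δ → ∀ b, Q.IsRoot b → η ≤ ‖x - b‖ := by
  obtain ⟨R, hR⟩ := exists_one_lt_norm_eval hQ
  -- Zeros have modulus below `R`, so a segment of length below 1 ending at a zero stays in this
  -- disc.
  obtain ⟨K, hK⟩ := (isCompact_closedBall (0 : ℂ) (R + 1)).exists_bound_of_continuousOn
    Q.continuous.continuousOn
  have hden : 0 < 4 * (Real.sqrt K + 1) := by positivity
  refine ⟨min 1 (δ / (4 * (Real.sqrt K + 1))), by positivity, fun x hx hAx b hb => ?_⟩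
  by_contra! hlt
  have hlt1 : ‖x - b‖ < 1 := hlt.trans_le (min_le_left _ _)
  have hlt2 : Real.sqrt K * ‖x - b‖ < δ / 2 := by
    have h1 := hlt.trans_le (min_le_right _ _)
    rw [lt_div_iff₀ hden] at h1
    nlinarith [norm_nonneg (x - b), Real.sqrt_nonneg K]
  have hbR : ‖b‖ < R := by
    by_contra! h
    have := hR b h
    rw [hb.eq_zero, norm_zero] at this
    linarith
  -- The closure of `U` lies in the compact image under `G` of a closed disc, hence in `Ω`: leaving
  -- `U` does not mean leaving `Ω`.
  set U : Set ℂ := Ω ∩ A ⁻¹' Metric.ball (A x) (δ / 2) with hU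
  have hAc : ContinuousOn A Ω := fun y hy => (hA y hy).continuousAt.continuousWithinAt
  have hUo : IsOpen U := hAc.isOpen_inter_preimage hΩ Metric.isOpen_ball
  have hball : Metric.closedBall (A x) (δ / 2) ⊆ strip μ 0 := fun w hw =>
    strip_mem_of_norm_sub_le (ε := δ / 2) (by linarith) hAx
      (by rwa [Metric.mem_closedBall, dist_eq_norm] at hw)
  set C : Set ℂ := G '' Metric.closedBall (A x) (δ / 2) with hC
  have hCc : IsClosed C :=
    ((isCompact_closedBall _ _).image_of_continuousOn (hGc.mono hball)).isClosed
  have hUC : closure U ⊆ C := by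
    refine closure_minimal ?_ hCc
    rintro y ⟨hy, hyA⟩
    exact ⟨A y, Metric.ball_subset_closedBall hyA, hGA y hy⟩
  have hCΩ : C ⊆ Ω := by
    rintro _ ⟨z, hz, rfl⟩
    exact hG z (hball hz)
  set p : ℝ → ℂ := fun s => x + s * (b - x) with hp
  have hpc : Continuous p := by fun_prop
  have hp1 : p 1 = b := by simp [hp]
  have hp0 : p 0 = x := by simp [hp]
  -- The segment from `x` to the zero `b ∉ Ω` must leave `U`. Up to the first exit time `s₀`,
  -- however, `A` changes by at most `√K ‖x - b‖ < δ / 2`, so the exit point is still in `U`.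
  obtain ⟨s₀, ⟨hs₀I, hs₀U⟩, hmin⟩ :=
    (isCompact_Icc.inter_right (hUo.isClosed_compl.preimage hpc) :
      IsCompact (Icc (0 : ℝ) 1 ∩ p ⁻¹' Uᶜ)).exists_isLeast
      ⟨1, ⟨zero_le_one, le_rfl⟩, fun h => hΩQ b (hp1 ▸ h.1) hb⟩
  have hxU : x ∈ U := ⟨hx, Metric.mem_ball_self (by linarith)⟩
  have hs₀pos : 0 < s₀ := by
    refine hs₀I.1.lt_of_ne fun h => hs₀U ?_
    rw [← h, hp0]; exact hxU
  have hlow : ∀ s ∈ Ico 0 s₀, p s ∈ U := by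
    intro s hs
    by_contra h
    exact absurd (hmin ⟨⟨hs.1, hs.2.le.trans hs₀I.2⟩, h⟩) (not_le.2 hs.2)
  have hps₀ : p s₀ ∈ Ω := by
    refine hCΩ (hUC (mem_closure_of_tendsto
      ((hpc.tendsto s₀).mono_left (nhdsWithin_le_nhds (s := Iio s₀))) ?_))
    filter_upwards [Ico_mem_nhdsLT hs₀pos] with s hs using hlow s hs
  have hpΩ : ∀ s ∈ Icc 0 s₀, p s ∈ Ω := by
    intro s hs
    rcases hs.2.eq_or_lt with h | h
    · rw [h]; exact hps₀
    · exact (hlow s ⟨hs.1, h⟩).1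
  have hmv := norm_image_sub_le_of_norm_deriv_le_segment' (f := fun s => A (p s))
    (f' := fun s => r (p s) * (b - x)) (a := 0) (b := s₀) (C := Real.sqrt K * ‖x - b‖)
    (fun s hs => by
      have h1 : HasDerivAt p (b - x) s := by
        have := ((hasDerivAt_id s).ofReal_comp.mul_const (b - x)).const_add x
        rw [Complex.ofReal_one, one_mul] at this
        exact this
      exact ((hA _ (hpΩ s hs)).comp s h1).hasDerivWithinAt)
    (fun s hs => by
      rw [norm_mul, norm_branch hr (hpΩ s ⟨hs.1, hs.2.le⟩), norm_sub_rev b x]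
      refine mul_le_mul_of_nonneg_right (Real.sqrt_le_sqrt (hK _ ?_)) (norm_nonneg _)
      rw [mem_closedBall_zero_iff]
      have h1 : p s = b + (1 - s : ℝ) * (x - b) := by
        simp only [hp]; push_cast; ring
      rw [h1]
      refine (norm_add_le _ _).trans ?_
      rw [norm_mul, Complex.norm_real, Real.norm_eq_abs, abs_of_nonneg (by linarith [hs.2, hs₀I.2])]
      nlinarith [norm_nonneg (x - b), hs.1])
    s₀ ⟨hs₀pos.le, le_rfl⟩
  refine hs₀U ⟨hps₀, ?_⟩
  rw [mem_preimage, Metric.mem_ball, dist_eq_norm]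
  simp only [hp0, sub_zero] at hmv
  refine hmv.trans_lt ?_
  nlinarith [hs₀I.2, mul_nonneg (Real.sqrt_nonneg K) (norm_nonneg (x - b))]

theorem pow_card_le_norm_prod {η : ℝ} (hη : 0 < η) {x : ℂ} (s : Multiset ℂ)
    (h : ∀ b ∈ s, η ≤ ‖x - b‖) : η ^ s.card ≤ ‖(s.map fun b => x - b).prod‖ := by
  induction s using Multiset.induction_on with
  | empty => simp
  | cons b s ih =>
    rw [Multiset.card_cons, Multiset.map_cons, Multiset.prod_cons, norm_mul, pow_succ, mul_comm]
    exact mul_le_mul (h b (Multiset.mem_cons_self b s))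
      (ih fun c hc => h c (Multiset.mem_cons_of_mem hc)) (by positivity) (norm_nonneg _)

theorem norm_sum_inv_le {η : ℝ} (hη : 0 < η) {x : ℂ} (s : Multiset ℂ)
    (h : ∀ b ∈ s, η ≤ ‖x - b‖) : ‖(s.map fun b => 1 / (x - b)).sum‖ ≤ s.card * η⁻¹ := by
  induction s using Multiset.induction_on with
  | empty => simp
  | cons b s ih =>
    rw [Multiset.card_cons, Multiset.map_cons, Multiset.sum_cons]
    refine (norm_add_le _ _).trans ?_
    have h1 : ‖1 / (x - b)‖ ≤ η⁻¹ := by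
      rw [norm_div, norm_one, one_div]
      exact inv_anti₀ hη (h b (Multiset.mem_cons_self b s))
    have h2 := ih fun c hc => h c (Multiset.mem_cons_of_mem hc)
    push_cast
    linarith

/-- The integral of `√Q` maps a Stokes domain conformally onto a strip. -/
theorem exists_isStripChart {Q : ℂ[X]} {Ω : Set ℂ} (hΩ : IsStokesDomain Q Ω) {a : ℂ}
    (ha : Q.IsRoot a) (haΩ : a ∈ frontier Ω) {r A : ℂ → ℂ} (hr : IsSqrtBranch Q Ω r)
    (hA : IsIntegralFrom Ω a r A) (hpos : ∀ x ∈ Ω, 0 < (A x).im) :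
    ∃ G : ℂ → ℂ, IsStripChart Q Ω r A (⨆ y ∈ Ω, ((A y).im : EReal)) G := by
  set μ : EReal := ⨆ y ∈ Ω, ((A y).im : EReal) with hμ
  have hacl : a ∈ closure Ω := frontier_subset_closure haΩ
  have hne : (𝓝[Ω] a).NeBot := mem_closure_iff_nhdsWithin_neBot.1 hacl
  obtain ⟨x₀, hx₀⟩ : Ω.Nonempty := closure_nonempty_iff.1 ⟨a, hacl⟩
  have hQ0 : Q ≠ 0 := by
    rintro rfl
    exact hΩ.not_isRoot hx₀ (by simp)
  have hQ : 0 < Q.degree := degree_pos_of_root hQ0 ha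
  have hr0 : ∀ x ∈ Ω, r x ≠ 0 := fun x hx => hΩ.branch_ne_zero hr hx
  have hinj := hΩ.injOn hQ hr hA.1
  have hAc : ContinuousOn A Ω := fun y hy => (hA.1 y hy).continuousAt.continuousWithinAt
  -- `A` is open, so the supremum of the heights is not attained.
  have hmaps : ∀ x ∈ Ω, A x ∈ strip μ 0 := by
    intro x hx
    refine ⟨hpos x hx, ?_⟩
    obtain ⟨e, hxe, heΩ, heA⟩ := exists_partialHomeomorph hΩ.1 hA.1 hx (hr0 x hx)
    have hAx : A x ∈ e.target := heA ▸ e.map_source hxe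
    obtain ⟨ε, hε, hball⟩ := Metric.isOpen_iff.1 e.open_target _ hAx
    have hmem : A x + (ε / 2 : ℝ) * Complex.I ∈ e.target := by
      apply hball
      rw [Metric.mem_ball, dist_eq_norm, add_sub_cancel_left, norm_mul, Complex.norm_I, mul_one,
        Complex.norm_real, Real.norm_eq_abs, abs_of_pos (by linarith)]
      linarith
    have hy := heΩ (e.map_target hmem)
    have hAy : A (e.symm (A x + (ε / 2 : ℝ) * Complex.I)) = A x + (ε / 2 : ℝ) * Complex.I := by
      have h := e.right_inv hmem
      rwa [heA] at h
    have h1 : (((A (e.symm (A x + (ε / 2 : ℝ) * Complex.I))).im : ℝ) : EReal) ≤ μ :=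
      le_iSup₂ (f := fun y (_ : y ∈ Ω) => ((A y).im : EReal)) _ hy
    refine lt_of_lt_of_le (EReal.coe_lt_coe_iff.2 ?_) h1
    rw [hAy]
    simp only [add_zero, Complex.add_im, Complex.mul_im, Complex.ofReal_re, Complex.I_im, mul_one,
      Complex.ofReal_im, Complex.I_re, mul_zero]
    linarith
  have hsurj : ∀ z ∈ strip μ 0, ∃ x ∈ Ω, A x = z := by
    rintro z ⟨hz1, hz2⟩
    obtain ⟨y₂, hy₂, hzy₂⟩ : ∃ y ∈ Ω, z.im < (A y).im := by
      rw [add_zero, hμ, lt_iSup_iff] at hz2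
      obtain ⟨y, hy⟩ := hz2
      obtain ⟨hyΩ, hy⟩ := lt_iSup_iff.1 hy
      exact ⟨y, hyΩ, EReal.coe_lt_coe_iff.1 hy⟩
    -- Arbitrarily small heights occur because `A` tends to 0 at `a`.
    obtain ⟨y₁, hy₁, hzy₁⟩ : ∃ y ∈ Ω, (A y).im < z.im := by
      have h1 : Tendsto (fun x => (A x).im) (𝓝[Ω] a) (𝓝 0) := by
        exact (Complex.continuous_im.tendsto 0).comp hA.2
      obtain ⟨y, hy⟩ := ((h1.eventually_lt_const hz1).and self_mem_nhdsWithin).exists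
      exact ⟨y, hy.2, hy.1⟩
    obtain ⟨y, hy, hyz⟩ := hΩ.isPreconnected.intermediate_value hy₁ hy₂
      (f := fun x => (A x).im) (Complex.continuous_im.comp_continuousOn hAc) ⟨hzy₁.le, hzy₂.le⟩
    obtain ⟨φ, -, -, hφ⟩ := hΩ.exists_lift hQ hr hA.1 ⟨y, hy⟩
    refine ⟨φ (z.re - (A y).re), (φ _).2, ?_⟩
    rw [hφ]
    have hyz : (A y).im = z.im := hyz
    apply Complex.ext <;> simp [hyz]
  choose! G hGΩ hAG using hsurj
  have hGA : ∀ x ∈ Ω, G (A x) = x := fun x hx =>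
    hinj (hGΩ _ (hmaps x hx)) hx (hAG _ (hmaps x hx))
  have hGc : ContinuousOn G (strip μ 0) := fun z hz =>
    (hasDerivAt_inverse hΩ.1 hr0 hA.1 hGΩ hAG hGA hz).continuousAt.continuousWithinAt
  -- The factorization of `Q` over its roots then bounds `|Q|` below, and `Q'/Q = ∑ 1/(x - b)` is
  -- bounded above.
  have hdist := fun (δ : ℝ) (hδ : 0 < δ) => exists_dist_root_bound hQ hΩ.1
    (fun x hx => hΩ.not_isRoot hx) hr hA.1 hGΩ hGc hGA hδ
  refine ⟨G, hΩ.1, hr, hr0, hA.1, hmaps, hGΩ, hAG, hGA, ?_, ?_⟩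
  · intro δ hδ
    obtain ⟨η, hη, hbd⟩ := hdist δ hδ
    refine ⟨(Real.sqrt (‖Q.leadingCoeff‖ * η ^ Q.roots.card))⁻¹, fun x hx hxδ => ?_⟩
    have hlc : 0 < ‖Q.leadingCoeff‖ := norm_pos_iff.2 (leadingCoeff_ne_zero.2 hQ0)
    rw [norm_inv, norm_branch hr hx]
    refine inv_anti₀ (by positivity) (Real.sqrt_le_sqrt ?_)
    rw [(IsAlgClosed.splits Q).eval_eq_prod_roots, norm_mul]
    refine mul_le_mul_of_nonneg_left (pow_card_le_norm_prod hη _ fun b hb => ?_) hlc.le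
    exact hbd x hx hxδ b ((mem_roots hQ0).1 hb)
  · intro δ hδ
    obtain ⟨η, hη, hbd⟩ := hdist δ hδ
    refine ⟨Q.roots.card * η⁻¹, fun x hx hxδ => ?_⟩
    have h1 := (IsAlgClosed.splits Q).eval_derivative_div_eval_of_ne_zero (x := x)
      (hΩ.not_isRoot hx)
    have h2 := norm_sum_inv_le hη (x := x) Q.roots
      fun b hb => hbd x hx hxδ b ((mem_roots hQ0).1 hb)
    rw [← h1] at h2
    have h3 : Q.derivative.eval x / (4 * Q.eval x) = 1 / 4 * (Q.derivative.eval x / Q.eval x) := by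
      rw [mul_comm 4, ← div_div]; ring
    rw [h3, norm_mul]
    refine le_trans ?_ h2
    have : ‖(1 / 4 : ℂ)‖ ≤ 1 := by norm_num
    exact mul_le_of_le_one_left (norm_nonneg _) this

end StripCharts


/-! ### The Laplace average on a strip -/

section LaplaceOperator

/-- The one-sided Laplace average of `f` along the horizontal direction `e`. -/
noncomputable def laplaceOp (e lam : ℝ) (f : ℂ → ℂ) (z : ℂ) : ℂ :=
  ∫ t in Iic (0 : ℝ), (Real.exp (lam * t) : ℂ) * f (z + ((e * t : ℝ) : ℂ))

theorem norm_laplaceOp_le {e lam B M : ℝ} (hB : B < lam) {f : ℂ → ℂ} {z : ℂ}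
    (hf : ∀ t ≤ 0, ‖f (z + ((e * t : ℝ) : ℂ))‖ ≤ M * Real.exp (-B * t)) :
    ‖laplaceOp e lam f z‖ ≤ M / (lam - B) := by
  have hpos : 0 < lam - B := by linarith
  have h1 : ∀ᵐ t ∂volume.restrict (Iic (0 : ℝ)),
      ‖(Real.exp (lam * t) : ℂ) * f (z + ((e * t : ℝ) : ℂ))‖ ≤ M * Real.exp ((lam - B) * t) := by
    filter_upwards [ae_restrict_mem measurableSet_Iic] with t ht
    rw [norm_mul, Complex.norm_real, Real.norm_eq_abs, Real.abs_exp]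
    calc Real.exp (lam * t) * ‖f (z + ((e * t : ℝ) : ℂ))‖
        ≤ Real.exp (lam * t) * (M * Real.exp (-B * t)) :=
          mul_le_mul_of_nonneg_left (hf t ht) (Real.exp_pos _).le
      _ = M * (Real.exp (lam * t) * Real.exp (-B * t)) := by ring
      _ = M * Real.exp ((lam - B) * t) := by rw [← Real.exp_add]; ring_nf
  refine (norm_integral_le_of_norm_le ((integrableOn_exp_mul_Iic hpos 0).const_mul M) h1).trans ?_
  rw [integral_const_mul, integral_exp_mul_Iic hpos, mul_zero, Real.exp_zero, mul_one_div]

theorem hasDerivAt_laplaceOp {e lam δ M : ℝ} {μ : EReal} (he : e = 1 ∨ e = -1) (hlam : 0 < lam)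
    {f : ℂ → ℂ} (hf : DifferentiableOn ℂ f (strip μ δ)) (hM : ∀ z ∈ strip μ δ, ‖f z‖ ≤ M)
    {z : ℂ} (hz : z ∈ strip μ δ) :
    HasDerivAt (laplaceOp e lam f) (e * (f z - lam * laplaceOp e lam f z)) z := by
  have hee : e * e = 1 := by rcases he with rfl | rfl <;> norm_num
  have hU := isOpen_strip μ δ
  obtain ⟨ε, hε, hball⟩ := Metric.isOpen_iff.1 hU z hz
  have hfd : ∀ w ∈ strip μ δ, HasDerivAt f (deriv f w) w := fun w hw =>
    (hf.differentiableAt (hU.mem_nhds hw)).hasDerivAt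
  have hfc : ∀ w ∈ strip μ δ, Continuous fun t : ℝ => f (w + ((e * t : ℝ) : ℂ)) := fun w hw =>
    hf.continuousOn.comp_continuous (by fun_prop) fun t => (add_real_mem_strip _).2 hw
  have hf'c : ∀ w ∈ strip μ δ, Continuous fun t : ℝ => deriv f (w + ((e * t : ℝ) : ℂ)) :=
    fun w hw => (hf.deriv hU).continuousOn.comp_continuous (by fun_prop)
      fun t => (add_real_mem_strip _).2 hw
  have hbz : Metric.ball z (ε / 2) ⊆ strip μ δ := fun w hw =>
    hball (Metric.ball_subset_ball (by linarith) hw)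
  have hexp : Continuous fun t : ℝ => ((Real.exp (lam * t) : ℝ) : ℂ) := by fun_prop
  -- Cauchy's estimate on discs of radius `ε / 4`; the strip is invariant under real translations,
  -- so the bound is uniform in `t` and dominates the differentiated integrand.
  have hderiv : ∀ w ∈ Metric.ball z (ε / 2), ∀ t : ℝ,
      ‖deriv f (w + ((e * t : ℝ) : ℂ))‖ ≤ M / (ε / 4) := by
    intro w hw t
    have hsub : Metric.closedBall (w + ((e * t : ℝ) : ℂ)) (ε / 4) ⊆ strip μ δ := by
      intro v hv
      have h1 : v - ((e * t : ℝ) : ℂ) ∈ Metric.ball z ε := by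
        rw [Metric.mem_closedBall, dist_eq_norm] at hv
        rw [Metric.mem_ball, dist_eq_norm] at hw ⊢
        calc ‖v - ((e * t : ℝ) : ℂ) - z‖ = ‖(v - (w + ((e * t : ℝ) : ℂ))) + (w - z)‖ := by
              congr 1; ring
          _ ≤ _ := norm_add_le _ _
          _ < ε := by linarith
      have := (add_real_mem_strip (e * t)).2 (hball h1)
      rwa [sub_add_cancel] at this
    refine Complex.norm_deriv_le_of_forall_mem_sphere_norm_le (by linarith) ?_
      fun v hv => hM v (hsub (Metric.sphere_subset_closedBall hv))
    refine DifferentiableOn.diffContOnCl_ball (U := strip μ δ) hf hsub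
  have hnorm : ∀ (c : ℂ) (t : ℝ), ‖((Real.exp (lam * t) : ℝ) : ℂ) * c‖ = Real.exp (lam * t) * ‖c‖ :=
    fun c t => by rw [norm_mul, Complex.norm_real, Real.norm_eq_abs, Real.abs_exp]
  have hint : ∀ (k : ℝ) (g : ℝ → ℂ), Continuous g → (∀ t, ‖g t‖ ≤ k) →
      IntegrableOn (fun t : ℝ => ((Real.exp (lam * t) : ℝ) : ℂ) * g t) (Iic 0) := by
    intro k g hg hk
    refine Integrable.mono' ((integrableOn_exp_mul_Iic hlam 0).const_mul k)
      (hexp.mul hg).aestronglyMeasurable (Eventually.of_forall fun t => ?_)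
    rw [hnorm, mul_comm]
    exact mul_le_mul_of_nonneg_right (hk t) (Real.exp_pos _).le
  have hmain := hasDerivAt_integral_of_dominated_loc_of_deriv_le (𝕜 := ℂ)
    (μ := volume.restrict (Iic (0 : ℝ)))
    (F := fun w t => ((Real.exp (lam * t) : ℝ) : ℂ) * f (w + ((e * t : ℝ) : ℂ)))
    (F' := fun w t => ((Real.exp (lam * t) : ℝ) : ℂ) * deriv f (w + ((e * t : ℝ) : ℂ)))
    (x₀ := z) (s := Metric.ball z (ε / 2))
    (bound := fun t => M / (ε / 4) * Real.exp (lam * t))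
    (Metric.ball_mem_nhds z (by linarith))
    (by
      filter_upwards [Metric.ball_mem_nhds z (half_pos hε)] with w hw
      exact (hexp.mul (hfc w (hbz hw))).aestronglyMeasurable)
    (hint M _ (hfc z hz) fun t => hM _ ((add_real_mem_strip _).2 hz))
    (hexp.mul (hf'c z hz)).aestronglyMeasurable
    (Eventually.of_forall fun t w hw => by
      rw [hnorm, mul_comm]
      exact mul_le_mul_of_nonneg_right (hderiv w hw t) (Real.exp_pos _).le)
    ((integrableOn_exp_mul_Iic hlam 0).const_mul _)
    (Eventually.of_forall fun t w hw => by
      have h1 := hfd _ ((add_real_mem_strip (e * t)).2 (hbz hw))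
      exact (h1.comp_add_const w _).const_mul _)
  refine hmain.2.congr_deriv ?_
  have hF'int := hmain.1
  have hFint := hint M _ (hfc z hz) fun t => hM _ ((add_real_mem_strip _).2 hz)
  set I₁ := ∫ t in Iic (0 : ℝ), ((Real.exp (lam * t) : ℝ) : ℂ) * deriv f (z + ((e * t : ℝ) : ℂ))
    with hI₁
  -- Integration by parts: the integrand is the derivative of `exp(lam t) f(z + e t)`, which
  -- vanishes at `-∞`.
  have hparts : ∫ t in Iic (0 : ℝ), (lam * (((Real.exp (lam * t) : ℝ) : ℂ) *
      f (z + ((e * t : ℝ) : ℂ))) + e * (((Real.exp (lam * t) : ℝ) : ℂ) *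
        deriv f (z + ((e * t : ℝ) : ℂ)))) = f z - 0 := by
    have := integral_Iic_of_hasDerivAt_of_tendsto' (a := 0) (m := 0)
      (f := fun t : ℝ => ((Real.exp (lam * t) : ℝ) : ℂ) * f (z + ((e * t : ℝ) : ℂ)))
      (f' := fun t : ℝ => (lam * (((Real.exp (lam * t) : ℝ) : ℂ) *
        f (z + ((e * t : ℝ) : ℂ))) + e * (((Real.exp (lam * t) : ℝ) : ℂ) *
          deriv f (z + ((e * t : ℝ) : ℂ)))))
      (fun t _ => by
        have h1 : HasDerivAt (fun t : ℝ => ((Real.exp (lam * t) : ℝ) : ℂ))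
            ((Real.exp (lam * t) * (lam * 1) : ℝ) : ℂ) t :=
          (((hasDerivAt_id t).const_mul lam).exp).ofReal_comp
        have h2 : HasDerivAt (fun t : ℝ => z + ((e * t : ℝ) : ℂ)) ((e * 1 : ℝ) : ℂ) t :=
          ((hasDerivAt_id t).const_mul e).ofReal_comp.const_add z
        have h3 := (hfd _ ((add_real_mem_strip (e * t)).2 hz)).comp t h2
        refine (h1.mul h3).congr_deriv ?_
        simp only [Function.comp_apply]
        push_cast
        ring)
      ((hFint.const_mul _).add (hF'int.const_mul _))
      (by
        have h1 : Tendsto (fun t : ℝ => M * Real.exp (lam * t)) atBot (𝓝 0) := by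
          have := (Real.tendsto_exp_atBot.comp (tendsto_id.const_mul_atBot hlam)).const_mul M
          simpa using this
        refine squeeze_zero_norm (fun t => ?_) h1
        rw [hnorm, mul_comm]
        exact mul_le_mul_of_nonneg_right (hM _ ((add_real_mem_strip _).2 hz)) (Real.exp_pos _).le)
    rw [this]
    simp
  rw [integral_add (hFint.const_mul _) (hF'int.const_mul _), integral_const_mul,
    integral_const_mul, sub_zero] at hparts
  change (lam : ℂ) * laplaceOp e lam f z + e * I₁ = f z at hparts
  have hee' : (e : ℂ) * e = 1 := by exact_mod_cast hee
  rw [← hparts]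
  linear_combination (-I₁) * hee'

end LaplaceOperator


/-! ### The operators K in the strip coordinate -/

section IntegralOperator

/-- The points of `Ω` that `A` maps to the strip `δ < Im z < μ - δ`. -/
def heightDomain (Ω : Set ℂ) (A : ℂ → ℂ) (μ : EReal) (δ : ℝ) : Set ℂ :=
  Ω ∩ A ⁻¹' strip μ δ

/-- The subleading WKB coefficient `-Q'/(4Q)`. -/
noncomputable def subleading (Q : ℂ[X]) (x : ℂ) : ℂ := -(Q.derivative.eval x / (4 * Q.eval x))

variable {Q : ℂ[X]} {Ω : Set ℂ} {r A G : ℂ → ℂ} {μ : EReal}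

theorem unit_real_cases (σ : ℤˣ) : (((σ : ℤ) : ℝ) = 1 ∨ ((σ : ℤ) : ℝ) = -1) := by
  rcases Int.units_eq_one_or σ with rfl | rfl <;> simp

theorem unit_mul_self (σ : ℤˣ) : (((σ : ℤ) : ℂ)) * ((σ : ℤ) : ℂ) = 1 := by
  rcases Int.units_eq_one_or σ with rfl | rfl <;> simp

theorem norm_unit (σ : ℤˣ) : ‖((σ : ℤ) : ℂ)‖ = 1 := by
  rcases Int.units_eq_one_or σ with rfl | rfl <;> simp

namespace IsStripChart

variable (h : IsStripChart Q Ω r A μ G)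
include h

theorem continuousOn : ContinuousOn A Ω := fun y hy =>
  (h.hasDerivAt y hy).continuousAt.continuousWithinAt

theorem isOpen_heightDomain (δ : ℝ) : IsOpen (heightDomain Ω A μ δ) :=
  h.continuousOn.isOpen_inter_preimage h.isOpen (isOpen_strip μ δ)

theorem eval_ne_zero {x : ℂ} (hx : x ∈ Ω) : Q.eval x ≠ 0 := by
  rw [← h.branch.2 x hx]
  exact pow_ne_zero 2 (h.ne_zero x hx)

theorem inv_mem_heightDomain {δ : ℝ} (hδ : 0 ≤ δ) {z : ℂ} (hz : z ∈ strip μ δ) :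
    G z ∈ heightDomain Ω A μ δ := by
  have hz0 := strip_subset hδ hz
  refine ⟨h.inv_mem z hz0, ?_⟩
  rw [mem_preimage, h.right_inv z hz0]; exact hz

theorem translate_mem {δ : ℝ} (hδ : 0 ≤ δ) {x : ℂ} (hx : x ∈ heightDomain Ω A μ δ) (t : ℝ) :
    G (A x + t) ∈ heightDomain Ω A μ δ :=
  h.inv_mem_heightDomain hδ ((add_real_mem_strip t).2 hx.2)

theorem hasDerivAt_translate {x : ℂ} (hx : x ∈ Ω) (t : ℝ) :
    HasDerivAt (fun s : ℝ => G (A x + s)) (r (G (A x + t)))⁻¹ t := by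
  have h1 := h.hasDerivAt_inv ((add_real_mem_strip t).2 (h.mapsTo x hx))
  have h2 : HasDerivAt (fun s : ℝ => A x + (s : ℂ)) ((1 : ℝ) : ℂ) t :=
    (hasDerivAt_id t).ofReal_comp.const_add (A x)
  refine (h1.comp t h2).congr_deriv ?_
  rw [Complex.ofReal_one, mul_one]

/-- Along any solution `A` grows at unit rate, and `G` recovers the point from its value; so the
arbitrary choice in `flow` is harmless. -/
theorem flow_eq {x : ℂ} (hx : x ∈ Ω) (t : ℝ) : flow Ω r t x = G (A x + t) := by
  have H : ∃ y : ℝ → ℂ, y 0 = x ∧ ∀ s, y s ∈ Ω ∧ HasDerivAt y (1 / r (y s)) s := by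
    refine ⟨fun s => G (A x + s), by simp [h.left_inv x hx], fun s => ⟨?_, ?_⟩⟩
    · exact h.inv_mem _ ((add_real_mem_strip s).2 (h.mapsTo x hx))
    · rw [one_div]; exact h.hasDerivAt_translate hx s
  obtain ⟨h0, hs⟩ := H.choose_spec
  rw [flow, dif_pos H]
  set y := H.choose
  have hconst : ∀ s, HasDerivAt (fun s : ℝ => A (y s) - s) 0 s := by
    intro s
    have h1 := (h.hasDerivAt _ (hs s).1).comp s (hs s).2
    rw [mul_one_div_cancel (h.ne_zero _ (hs s).1)] at h1
    have h2 := h1.sub ((hasDerivAt_id s).ofReal_comp)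
    rw [Complex.ofReal_one, sub_self] at h2
    exact h2
  have h3 := is_const_of_deriv_eq_zero (fun s => (hconst s).differentiableAt)
    (fun s => (hconst s).deriv) t 0
  simp only [h0, Complex.ofReal_zero, sub_zero] at h3
  rw [← h3, sub_add_cancel, h.left_inv _ (hs t).1]

theorem hasDerivAt_branch {x : ℂ} (hx : x ∈ Ω) :
    HasDerivAt r (-2 * subleading Q x * r x) x := by
  have h1 : HasDerivAt r (deriv r x) x :=
    (h.branch.1.differentiableAt (h.isOpen.mem_nhds hx)).hasDerivAt
  have h2 : HasDerivAt (fun y => r y ^ 2) (Q.derivative.eval x) x := by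
    refine (Q.hasDerivAt x).congr_of_eventuallyEq ?_
    filter_upwards [h.isOpen.mem_nhds hx] with y hy using h.branch.2 y hy
  have h3 := (h1.pow 2).unique h2
  have h4 : deriv r x = -2 * subleading Q x * r x := by
    have hr0 := h.ne_zero x hx
    rw [subleading, ← h3, ← h.branch.2 x hx]
    push_cast
    field_simp
    ring
  rw [← h4]; exact h1

/-- The growth of `√Q` along the flow. -/
theorem norm_branch_le {δ : ℝ} (hδ : 0 ≤ δ) {B : ℝ}
    (hB : ∀ x ∈ heightDomain Ω A μ δ, ‖2 * subleading Q x * (r x)⁻¹‖ ≤ B)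
    {e : ℝ} (he : e = 1 ∨ e = -1) {x : ℂ} (hx : x ∈ heightDomain Ω A μ δ) {t : ℝ} (ht : t ≤ 0) :
    ‖r x‖ ≤ ‖r (G (A x + ((e * t : ℝ) : ℂ)))‖ * Real.exp (-B * t) := by
  have hee : |e| = 1 := by rcases he with rfl | rfl <;> simp
  -- Grönwall's inequality is run from the displaced point `x₁` back to `x`, over the time `-t ≥ 0`.
  set x₁ := G (A x + ((e * t : ℝ) : ℂ)) with hx₁
  have hx₁D : x₁ ∈ heightDomain Ω A μ δ := h.translate_mem hδ hx _
  have hAx₁ : A x₁ = A x + ((e * t : ℝ) : ℂ) :=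
    h.right_inv _ ((add_real_mem_strip _).2 (h.mapsTo x hx.1))
  have hd : ∀ s : ℝ, HasDerivAt (fun s : ℝ => r (G (A x₁ + ((e * s : ℝ) : ℂ))))
      (-2 * subleading Q (G (A x₁ + ((e * s : ℝ) : ℂ))) * r (G (A x₁ + ((e * s : ℝ) : ℂ))) *
        (e * (r (G (A x₁ + ((e * s : ℝ) : ℂ))))⁻¹)) s := by
    intro s
    have h1 := (h.hasDerivAt_translate hx₁D.1 (e * s)).scomp s ((hasDerivAt_id s).const_mul e)
    have h2 := (h.hasDerivAt_branch (h.translate_mem hδ hx₁D (e * s)).1).comp s h1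
    rw [mul_one, Complex.real_smul] at h2
    exact h2
  have := norm_le_gronwallBound_of_norm_deriv_right_le
    (f := fun s : ℝ => r (G (A x₁ + ((e * s : ℝ) : ℂ)))) (a := 0) (b := -t)
    (δ := ‖r x₁‖) (K := B) (ε := 0)
    (fun s _ => (hd s).continuousAt.continuousWithinAt)
    (fun s _ => (hd s).hasDerivWithinAt)
    (by simp [h.left_inv _ hx₁D.1])
    (fun s _ => by
      have hmem := h.translate_mem hδ hx₁D (e * s)
      have h1 := hB _ hmem
      set y := G (A x₁ + ((e * s : ℝ) : ℂ))
      have h2 : -2 * subleading Q y * r y * (e * (r y)⁻¹)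
          = -(e * (2 * subleading Q y * (r y)⁻¹) * r y) := by ring
      rw [h2, norm_neg, norm_mul, norm_mul, Complex.norm_real, Real.norm_eq_abs, hee, one_mul,
        add_zero]
      exact mul_le_mul_of_nonneg_right h1 (norm_nonneg _))
    (-t) ⟨by linarith, le_rfl⟩
  rw [gronwallBound_ε0, sub_zero] at this
  have hend : G (A x₁ + ((e * -t : ℝ) : ℂ)) = x := by
    rw [hAx₁, add_assoc, ← Complex.ofReal_add]
    simp [h.left_inv x hx.1]
  simp only [hend] at this
  rwa [neg_mul, ← mul_neg]

theorem intOp_eq (σ : ℤˣ) (η : ℝ) (f : ℂ → ℂ) {x : ℂ} (hx : x ∈ Ω) :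
    intOp Q Ω r σ η f x = ((σ : ℤ) : ℂ) * r x *
      laplaceOp ((σ : ℤ) : ℝ) (2 / η) (fun z => f (G z) / Q.eval (G z)) (A x) := by
  rw [intOp, laplaceOp]
  congr 1
  refine integral_congr_ae (Eventually.of_forall fun t => ?_)
  simp only [h.flow_eq hx]
  rw [div_mul_eq_mul_div]

theorem differentiableOn_comp_inv {δ : ℝ} (hδ : 0 ≤ δ) {f : ℂ → ℂ}
    (hf : DifferentiableOn ℂ f (heightDomain Ω A μ δ)) :
    DifferentiableOn ℂ (fun z => f (G z)) (strip μ δ) := by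
  intro z hz
  have h1 := hf.differentiableAt ((h.isOpen_heightDomain δ).mem_nhds (h.inv_mem_heightDomain hδ hz))
  exact (h1.comp z (h.hasDerivAt_inv (strip_subset hδ hz)).differentiableAt).differentiableWithinAt

/-- The ratio of `√Q` at `x` to `√Q` at the flowed point grows at most like `exp(-B t)`. For `η B ≤
1` the kernel `exp(2t/η)` absorbs this and still decays at rate at least `1/η`, which yields the
gain `η`. -/
theorem norm_intOp_le {δ : ℝ} (hδ : 0 ≤ δ) {B : ℝ}
    (hB : ∀ x ∈ heightDomain Ω A μ δ, ‖2 * subleading Q x * (r x)⁻¹‖ ≤ B)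
    {M : ℝ} {f : ℂ → ℂ} (hM : ∀ x ∈ heightDomain Ω A μ δ, ‖f x * (r x)⁻¹‖ ≤ M) (σ : ℤˣ) {η : ℝ}
    (hη : 0 < η) (hηB : η * B ≤ 1) {x : ℂ} (hx : x ∈ heightDomain Ω A μ δ) :
    ‖intOp Q Ω r σ η f x‖ ≤ M * η := by
  have hr0 := norm_pos_iff.2 (h.ne_zero x hx.1)
  have hM0 : 0 ≤ M := (norm_nonneg _).trans (hM x hx)
  have hlam : 1 / η ≤ 2 / η - B := by
    rw [le_sub_iff_add_le, div_add' _ _ _ hη.ne']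
    exact div_le_div_of_nonneg_right (by linarith) hη.le
  have hlam0 : 0 < 1 / η := by positivity
  rw [h.intOp_eq σ η f hx.1, norm_mul, norm_mul, norm_unit, one_mul]
  have h1 := norm_laplaceOp_le (e := ((σ : ℤ) : ℝ)) (lam := 2 / η) (B := B) (M := M * ‖r x‖⁻¹)
    (by linarith) (f := fun z => f (G z) / Q.eval (G z)) (z := A x) (fun t ht => by
      have hmem := h.translate_mem hδ hx (((σ : ℤ) : ℝ) * t)
      have hg := h.norm_branch_le hδ hB (unit_real_cases σ) hx ht
      have hb := hM _ hmem
      have hq := h.branch.2 _ hmem.1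
      have hry := norm_pos_iff.2 (h.ne_zero _ hmem.1)
      set y := G (A x + ((((σ : ℤ) : ℝ) * t : ℝ) : ℂ))
      rw [← hq, norm_div, norm_pow]
      rw [norm_mul, norm_inv] at hb
      have e1 : ‖f y‖ / ‖r y‖ ^ 2 = (‖f y‖ * ‖r y‖⁻¹) * ‖r y‖⁻¹ := by
        field_simp
      rw [e1]
      have e2 : ‖r y‖⁻¹ ≤ ‖r x‖⁻¹ * Real.exp (-B * t) := by
        rw [inv_le_iff_one_le_mul₀ hry]
        have : ‖r x‖⁻¹ * ‖r x‖ ≤ ‖r x‖⁻¹ * (‖r y‖ * Real.exp (-B * t)) :=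
          mul_le_mul_of_nonneg_left hg (inv_nonneg.2 hr0.le)
        rw [inv_mul_cancel₀ hr0.ne'] at this
        linarith
      calc ‖f y‖ * ‖r y‖⁻¹ * ‖r y‖⁻¹ ≤ M * (‖r x‖⁻¹ * Real.exp (-B * t)) :=
            mul_le_mul hb e2 (inv_nonneg.2 hry.le) hM0
        _ = _ := by ring)
  calc ‖r x‖ * _ ≤ ‖r x‖ * (M * ‖r x‖⁻¹ / (2 / η - B)) := mul_le_mul_of_nonneg_left h1 hr0.le
    _ = M / (2 / η - B) := by field_simp
    _ ≤ M / (1 / η) := div_le_div_of_nonneg_left hM0 hlam0 hlam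
    _ = M * η := by rw [div_div_eq_mul_div, div_one]

/-- The prefactor contributes `r' = -2 s₁ r` and the Laplace average its own first-order equation;
`σ² = 1` makes the source term exactly `f`. -/
theorem hasDerivAt_intOp {δ : ℝ} (hδ : 0 ≤ δ) {κ : ℝ}
    (hκ : ∀ x ∈ heightDomain Ω A μ δ, ‖(r x)⁻¹‖ ≤ κ)
    {M : ℝ} {f : ℂ → ℂ} (hf : DifferentiableOn ℂ f (heightDomain Ω A μ δ))
    (hM : ∀ x ∈ heightDomain Ω A μ δ, ‖f x * (r x)⁻¹‖ ≤ M) (σ : ℤˣ) {η : ℝ}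
    (hη : 0 < η) {x : ℂ} (hx : x ∈ heightDomain Ω A μ δ) :
    HasDerivAt (intOp Q Ω r σ η f) (f x - 2 * subleading Q x * intOp Q Ω r σ η f x
      - 2 / η * (((σ : ℤ) : ℂ) * r x) * intOp Q Ω r σ η f x) x := by
  have hFd : DifferentiableOn ℂ (fun z => f (G z) / Q.eval (G z)) (strip μ δ) :=
    h.differentiableOn_comp_inv hδ (f := fun y => f y / Q.eval y)
      (hf.div Q.differentiable.differentiableOn fun y hy => h.eval_ne_zero hy.1)
  have hFM : ∀ z ∈ strip μ δ, ‖f (G z) / Q.eval (G z)‖ ≤ M * κ := by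
    intro z hz
    have hy := h.inv_mem_heightDomain hδ hz
    rw [← h.branch.2 _ hy.1, pow_two, ← div_div, div_eq_mul_inv, div_eq_mul_inv, norm_mul]
    exact mul_le_mul (hM _ hy) (hκ _ hy) (norm_nonneg _) ((norm_nonneg _).trans (hM _ hy))
  have hT := hasDerivAt_laplaceOp (unit_real_cases σ) (lam := 2 / η) (by positivity) hFd hFM hx.2
  have h1 := (((h.hasDerivAt_branch hx.1).const_mul ((σ : ℤ) : ℂ))).mul
    (hT.comp x (h.hasDerivAt x hx.1))
  have h2 : intOp Q Ω r σ η f =ᶠ[𝓝 x] fun y => ((σ : ℤ) : ℂ) * r y *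
      laplaceOp ((σ : ℤ) : ℝ) (2 / η) (fun z => f (G z) / Q.eval (G z)) (A y) := by
    filter_upwards [h.isOpen.mem_nhds hx.1] with y hy using h.intOp_eq σ η f hy
  refine (h1.congr_of_eventuallyEq h2).congr_deriv ?_
  rw [h.intOp_eq σ η f hx.1, h.left_inv x hx.1, ← h.branch.2 x hx.1]
  have hr0 := h.ne_zero x hx.1
  have hs := unit_mul_self σ
  simp only [Function.comp_apply]
  set L := laplaceOp ((σ : ℤ) : ℝ) (2 / η) (fun z => f (G z) / Q.eval (G z)) (A x)
  have hfr : r x * r x * (f x / r x ^ 2) = f x := by field_simp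
  push_cast
  linear_combination (r x * r x * (f x / r x ^ 2)) * hs + hfr

end IsStripChart

end IntegralOperator


/-- Links the recursions, whose sums omit the index 0, to Cauchy products. -/
theorem sum_antidiagonal_add_two {R : Type*} [CommRing R] (a : ℕ → R) (n : ℕ) :
    ∑ p ∈ Finset.HasAntidiagonal.antidiagonal (n + 2), a p.1 * a p.2 =
      2 * (a 0 * a (n + 2)) + ∑ i : Fin (n + 1), a (i + 1) * a (n + 1 - i) := by
  rw [Finset.Nat.sum_antidiagonal_eq_sum_range_succ (fun i j => a i * a j), Finset.sum_range_succ,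
    Finset.sum_range_succ', Nat.sub_self, Nat.sub_zero,
    Fin.sum_univ_eq_sum_range (fun i => a (i + 1) * a (n + 1 - i)) (n + 1)]
  have : ∀ i ∈ Finset.range (n + 1), a (i + 1) * a (n + 2 - (i + 1)) = a (i + 1) * a (n + 1 - i) :=
    fun i _ => by rw [show n + 2 - (i + 1) = n + 1 - i by omega]
  rw [Finset.sum_congr rfl this]
  ring

/-! ### Boundedness away from the boundary heights; the formal coefficients -/

section HeightBounded

theorem sourceTerm_eq (Q : ℂ[X]) (x : ℂ) :
    sourceTerm Q x = -(deriv (subleading Q) x + subleading Q x ^ 2) := rfl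

variable {Q : ℂ[X]} {Ω : Set ℂ} {r A G : ℂ → ℂ} {μ : EReal}

/-- Boundedness on each of the sets `δ < Im A < μ - δ`, `δ > 0`. -/
def HeightBounded (Ω : Set ℂ) (A : ℂ → ℂ) (μ : EReal) (f : ℂ → ℂ) : Prop :=
  ∀ δ : ℝ, 0 < δ → ∃ M : ℝ, ∀ x ∈ heightDomain Ω A μ δ, ‖f x‖ ≤ M

theorem heightBounded_const (c : ℂ) : HeightBounded Ω A μ fun _ => c :=
  fun _ _ => ⟨‖c‖, fun _ _ => le_rfl⟩

theorem HeightBounded.add {f g : ℂ → ℂ} (hf : HeightBounded Ω A μ f)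
    (hg : HeightBounded Ω A μ g) : HeightBounded Ω A μ fun x => f x + g x := by
  intro δ hδ
  obtain ⟨M, hM⟩ := hf δ hδ
  obtain ⟨N, hN⟩ := hg δ hδ
  exact ⟨M + N, fun x hx => (norm_add_le _ _).trans (add_le_add (hM x hx) (hN x hx))⟩

theorem HeightBounded.mul {f g : ℂ → ℂ} (hf : HeightBounded Ω A μ f)
    (hg : HeightBounded Ω A μ g) : HeightBounded Ω A μ fun x => f x * g x := by
  intro δ hδ
  obtain ⟨M, hM⟩ := hf δ hδ
  obtain ⟨N, hN⟩ := hg δ hδ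
  refine ⟨M * N, fun x hx => ?_⟩
  rw [norm_mul]
  exact mul_le_mul (hM x hx) (hN x hx) (norm_nonneg _) ((norm_nonneg _).trans (hM x hx))

theorem HeightBounded.sum {ι : Type*} {s : Finset ι} {f : ι → ℂ → ℂ}
    (hf : ∀ i ∈ s, HeightBounded Ω A μ (f i)) : HeightBounded Ω A μ fun x => ∑ i ∈ s, f i x := by
  classical
  induction s using Finset.induction_on with
  | empty => simpa using heightBounded_const 0
  | insert i s hi ih =>
    simp only [Finset.sum_insert hi]
    exact (hf i (Finset.mem_insert_self i s)).add
      (ih fun j hj => hf j (Finset.mem_insert_of_mem hj))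

theorem HeightBounded.exists_pos {f : ℂ → ℂ} (hf : HeightBounded Ω A μ f) {δ : ℝ} (hδ : 0 < δ) :
    ∃ M : ℝ, 0 < M ∧ ∀ x ∈ heightDomain Ω A μ δ, ‖f x‖ ≤ M := by
  obtain ⟨M, hM⟩ := hf δ hδ
  exact ⟨max M 1, by positivity, fun x hx => (hM x hx).trans (le_max_left _ _)⟩

/-- The division by `s₀` is distributed so that every term carries `r⁻¹`; the derivative then has
the weight needed for Cauchy's estimate. -/
theorem formalCoeff_add_two (σ : ℤˣ) (n : ℕ) (x : ℂ) :
    formalCoeff Q (fun x => ((σ : ℤ) : ℂ) * r x) (n + 2) x = -(1 / 2 * ((σ : ℤ) : ℂ)) *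
      ((∑ i : Fin (n + 1), formalCoeff Q (fun x => ((σ : ℤ) : ℂ) * r x) (i + 1) x *
          formalCoeff Q (fun x => ((σ : ℤ) : ℂ) * r x) (n + 1 - i) x * (r x)⁻¹)
        + deriv (formalCoeff Q (fun x => ((σ : ℤ) : ℂ) * r x) (n + 1)) x * (r x)⁻¹) := by
  rw [formalCoeff]
  have hσ : (((σ : ℤ) : ℂ))⁻¹ = ((σ : ℤ) : ℂ) := inv_eq_of_mul_eq_one_left (unit_mul_self σ)
  have h2 : 1 / (2 * (((σ : ℤ) : ℂ) * r x)) = 1 / 2 * ((σ : ℤ) : ℂ) * (r x)⁻¹ := by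
    rw [one_div, mul_inv, mul_inv, hσ]; ring
  beta_reduce
  rw [h2, ← Finset.sum_mul]
  ring

namespace IsStripChart

variable (h : IsStripChart Q Ω r A μ G)
include h

theorem heightBounded_inv : HeightBounded Ω A μ fun x => (r x)⁻¹ := fun δ hδ =>
  let ⟨κ, hκ⟩ := h.inv_bound δ hδ
  ⟨κ, fun x hx => hκ x hx.1 hx.2⟩

theorem heightBounded_subleading : HeightBounded Ω A μ (subleading Q) := fun δ hδ =>
  let ⟨M, hM⟩ := h.logDeriv_bound δ hδ
  ⟨M, fun x hx => by rw [subleading, norm_neg]; exact hM x hx.1 hx.2⟩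

theorem differentiableOn_subleading : DifferentiableOn ℂ (subleading Q) Ω :=
  ((Q.derivative.differentiable.differentiableOn).div
    (Q.differentiable.differentiableOn.const_mul 4)
    fun _ hx => mul_ne_zero (by norm_num) (h.eval_ne_zero hx)).neg

/-- Cauchy's estimate in the coordinate `A`. -/
theorem heightBounded_deriv {f : ℂ → ℂ} (hf : DifferentiableOn ℂ f Ω)
    (hb : HeightBounded Ω A μ f) : HeightBounded Ω A μ fun x => deriv f x * (r x)⁻¹ := by
  intro δ hδ
  obtain ⟨M, hM⟩ := hb (δ / 2) (by linarith)
  refine ⟨M / (δ / 2), fun x hx => ?_⟩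
  have hz0 := h.mapsTo x hx.1
  have hd : HasDerivAt (fun z => f (G z)) (deriv f x * (r x)⁻¹) (A x) := by
    have h1 : HasDerivAt f (deriv f x) (G (A x)) := by
      rw [h.left_inv x hx.1]
      exact (hf.differentiableAt (h.isOpen.mem_nhds hx.1)).hasDerivAt
    have h2 := h.hasDerivAt_inv hz0
    rw [h.left_inv x hx.1] at h2
    exact h1.comp _ h2
  change ‖deriv f x * (r x)⁻¹‖ ≤ _
  rw [← hd.deriv]
  have hsub : Metric.closedBall (A x) (δ / 2) ⊆ strip μ (δ / 2) := fun w hw =>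
    strip_mem_of_norm_sub_le (ε := δ / 2) (by linarith) hx.2
      (by rwa [Metric.mem_closedBall, dist_eq_norm] at hw)
  refine Complex.norm_deriv_le_of_forall_mem_sphere_norm_le (by linarith) ?_ fun w hw =>
    hM _ (h.inv_mem_heightDomain (by linarith) (hsub (Metric.sphere_subset_closedBall hw)))
  exact DifferentiableOn.diffContOnCl_ball (U := strip μ (δ / 2))
    (h.differentiableOn_comp_inv (by linarith) (hf.mono inter_subset_left)) hsub

theorem differentiableOn_sourceTerm : DifferentiableOn ℂ (sourceTerm Q) Ω :=
  (((h.differentiableOn_subleading.deriv h.isOpen)).add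
    (h.differentiableOn_subleading.pow 2)).neg

theorem heightBounded_sourceTerm : HeightBounded Ω A μ fun x => sourceTerm Q x * (r x)⁻¹ := by
  have h1 := h.heightBounded_deriv h.differentiableOn_subleading h.heightBounded_subleading
  have h2 := (h.heightBounded_subleading.mul h.heightBounded_subleading).mul h.heightBounded_inv
  have h3 := (heightBounded_const (-1)).mul (h1.add h2)
  convert h3 using 2 with x
  rw [sourceTerm_eq]
  ring

/-- Boundedness starts at `n = 1`, since `s₀ = ±√Q` may be unbounded; the recursion for `n ≥ 2` only
multiplies and differentiates coefficients of positive index. -/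
theorem formalCoeff_properties (σ : ℤˣ) (n : ℕ) :
    DifferentiableOn ℂ (formalCoeff Q (fun x => ((σ : ℤ) : ℂ) * r x) n) Ω ∧
      (1 ≤ n → HeightBounded Ω A μ (formalCoeff Q (fun x => ((σ : ℤ) : ℂ) * r x) n)) := by
  induction n using Nat.strong_induction_on with
  | _ n ih =>
    match n, ih with
    | 0, _ =>
      refine ⟨?_, fun h0 => absurd h0 (by norm_num)⟩
      have : formalCoeff Q (fun x => ((σ : ℤ) : ℂ) * r x) 0 = fun x => ((σ : ℤ) : ℂ) * r x := by
        rw [formalCoeff]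
      rw [this]
      exact h.branch.1.const_mul _
    | 1, _ =>
      have : formalCoeff Q (fun x => ((σ : ℤ) : ℂ) * r x) 1 = subleading Q := by
        rw [formalCoeff]; rfl
      rw [this]
      exact ⟨h.differentiableOn_subleading, fun _ => h.heightBounded_subleading⟩
    | n + 2, ih =>
      have heq := funext (formalCoeff_add_two (Q := Q) (r := r) σ n)
      rw [heq]
      have hrd : DifferentiableOn ℂ (fun x => (r x)⁻¹) Ω := h.branch.1.inv h.ne_zero
      have hn := ih (n + 1) (by omega)
      constructor
      · refine DifferentiableOn.const_mul (DifferentiableOn.add ?_ ?_) _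
        · refine DifferentiableOn.fun_sum fun i _ => ?_
          exact ((ih (i + 1) (by omega)).1.mul (ih (n + 1 - i) (by omega)).1).mul hrd
        · exact (hn.1.deriv h.isOpen).mul hrd
      · intro _
        refine (heightBounded_const _).mul (HeightBounded.add (HeightBounded.sum fun i _ => ?_) ?_)
        · exact (((ih (i + 1) (by omega)).2 (by omega)).mul
            ((ih (n + 1 - i) (by omega)).2 (by omega))).mul h.heightBounded_inv
        · exact h.heightBounded_deriv hn.1 (hn.2 (by omega))

/-- The formal series solves the Riccati equation order by order. -/
theorem formalCoeff_riccati (σ : ℤˣ) (n : ℕ) {x : ℂ} (hx : x ∈ Ω) :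
    ∑ p ∈ Finset.HasAntidiagonal.antidiagonal (n + 1), formalCoeff Q (fun x => ((σ : ℤ) : ℂ) * r x) p.1 x *
      formalCoeff Q (fun x => ((σ : ℤ) : ℂ) * r x) p.2 x +
      deriv (formalCoeff Q (fun x => ((σ : ℤ) : ℂ) * r x) n) x = 0 := by
  have hs0 : formalCoeff Q (fun x => ((σ : ℤ) : ℂ) * r x) 0 = fun x => ((σ : ℤ) : ℂ) * r x := by
    rw [formalCoeff]
  have hr0 := h.ne_zero x hx
  have hσ := unit_mul_self σ
  match n with
  | 0 =>
    have hs1 : formalCoeff Q (fun x => ((σ : ℤ) : ℂ) * r x) 1 = subleading Q := by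
      rw [formalCoeff]; rfl
    rw [Finset.Nat.antidiagonal_succ]
    simp only [Finset.Nat.antidiagonal_zero, Finset.map_singleton, Finset.sum_cons,
      Finset.sum_singleton, Function.Embedding.prodMap, Function.Embedding.coeFn_mk,
      Prod.map_apply, Function.Embedding.refl_apply, Nat.succ_eq_add_one, zero_add]
    rw [hs1, hs0, ((h.hasDerivAt_branch hx).const_mul _).deriv]
    ring
  | n + 1 =>
    have := sum_antidiagonal_add_two
      (fun k => formalCoeff Q (fun x => ((σ : ℤ) : ℂ) * r x) k x) n
    rw [this, formalCoeff_add_two σ n x, hs0, ← Finset.sum_mul]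
    set S := ∑ i : Fin (n + 1), formalCoeff Q (fun x => ((σ : ℤ) : ℂ) * r x) (i + 1) x *
          formalCoeff Q (fun x => ((σ : ℤ) : ℂ) * r x) (n + 1 - i) x
    set D := deriv (formalCoeff Q (fun x => ((σ : ℤ) : ℂ) * r x) (n + 1)) x
    have hrr : r x * (r x)⁻¹ = 1 := mul_inv_cancel₀ hr0
    linear_combination (-(S + D) * (r x * (r x)⁻¹)) * hσ - (S + D) * hrr

end IsStripChart

end HeightBounded


/-! ### Convergence of the correction series and the Riccati equation -/

section Correction

theorem catalan_le_four_pow (n : ℕ) : catalan n ≤ 4 ^ n := by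
  rw [catalan_eq_centralBinom_div]
  exact (Nat.div_le_self _ _).trans (Nat.centralBinom_le_four_pow n)

/-- Here `e ρ` stands for `s₀`, `s` and `ds` for `s₁` and its derivative; the derivatives of `s₀`
and of `W` are already replaced by their equations. -/
theorem riccati_algebra {η e : ℂ} (hη : η ≠ 0) (he : e * e = 1) (s ds ρ W : ℂ) :
    η * (e * (-2 * s * ρ) + ds * η + η * (-(ds + s ^ 2) - W ^ 2 - (2 * s + 2 / η * (e * ρ)) * W))
      + (e * ρ + s * η + η * W) ^ 2 - ρ ^ 2 = 0 := by
  field_simp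
  linear_combination (ρ ^ 2) * he

/-- The size of the constants for which the correction series converges. -/
structure IsAdmissible (Q : ℂ[X]) (Ω : Set ℂ) (r A : ℂ → ℂ) (μ : EReal) (δ κ B M η : ℝ) :
    Prop where
  pos_height : 0 < δ
  inv_le : ∀ x ∈ heightDomain Ω A μ δ, ‖(r x)⁻¹‖ ≤ κ
  subleading_le : ∀ x ∈ heightDomain Ω A μ δ, ‖2 * subleading Q x * (r x)⁻¹‖ ≤ B
  source_le : ∀ x ∈ heightDomain Ω A μ δ, ‖sourceTerm Q x * (r x)⁻¹‖ ≤ M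
  pos_const : 0 < κ ∧ 0 < B ∧ 0 < M
  pos : 0 < η
  le_one : η ≤ 1
  mul_le : η * B ≤ 1
  sq_le : 8 * (η ^ 2 * M * κ) ≤ 1

variable {Q : ℂ[X]} {Ω : Set ℂ} {r A G : ℂ → ℂ} {μ : EReal} {δ κ B M η : ℝ}

theorem corrTerm_one (σ : ℤˣ) (η : ℝ) :
    corrTerm Q Ω r σ η 1 = intOp Q Ω r σ η (sourceTerm Q) := by
  rw [corrTerm]

theorem corrTerm_add_two (σ : ℤˣ) (η : ℝ) (n : ℕ) :
    corrTerm Q Ω r σ η (n + 2) = fun x => -∑ i : Fin (n + 1), intOp Q Ω r σ η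
      (fun y => corrTerm Q Ω r σ η (i + 1) y * corrTerm Q Ω r σ η (n + 1 - i) y) x := by
  conv_lhs => rw [corrTerm]

theorem corrTerm_zero (σ : ℤˣ) (η : ℝ) (x : ℂ) : corrTerm Q Ω r σ η 0 x = 0 := by
  rw [corrTerm]

namespace IsStripChart

variable (h : IsStripChart Q Ω r A μ G) (hc : IsAdmissible Q Ω r A μ δ κ B M η)
include h hc

/-- The quadratic recursion for the bounds is that of the Catalan numbers. Raising the index by one
costs a further `M η` from the product, `κ` from the weight `r⁻¹` and `η` from the operator: the
factor `η² M κ`. -/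
theorem corrTerm_properties (σ : ℤˣ) (n : ℕ) :
    DifferentiableOn ℂ (corrTerm Q Ω r σ η (n + 1)) (heightDomain Ω A μ δ) ∧
      ∀ x ∈ heightDomain Ω A μ δ, ‖corrTerm Q Ω r σ η (n + 1) x‖ ≤
        catalan n * (M * η) * (η ^ 2 * M * κ) ^ n := by
  obtain ⟨hκ, hB, hM⟩ := hc.pos_const
  have hη := hc.pos
  induction n using Nat.strong_induction_on with
  | _ n ih =>
    match n, ih with
    | 0, _ =>
      rw [zero_add, corrTerm_one]
      refine ⟨fun x hx => ?_, fun x hx => ?_⟩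
      · exact (h.hasDerivAt_intOp hc.pos_height.le hc.inv_le
          (h.differentiableOn_sourceTerm.mono inter_subset_left) hc.source_le σ hη
          hx).differentiableAt.differentiableWithinAt
      · simpa using h.norm_intOp_le hc.pos_height.le hc.subleading_le hc.source_le σ hη hc.mul_le hx
    | n + 1, ih =>
      have key : ∀ i : Fin (n + 1), DifferentiableOn ℂ (fun y => corrTerm Q Ω r σ η (i + 1) y *
            corrTerm Q Ω r σ η (n + 1 - i) y) (heightDomain Ω A μ δ) ∧
          ∀ x ∈ heightDomain Ω A μ δ, ‖corrTerm Q Ω r σ η (i + 1) x *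
            corrTerm Q Ω r σ η (n + 1 - i) x * (r x)⁻¹‖ ≤
              catalan i * catalan (n - i) * ((M * η) * (η ^ 2 * M * κ) ^ n * (M * η * κ)) := by
        intro i
        have hi : (i : ℕ) ≤ n := Nat.lt_succ_iff.1 i.2
        rw [show n + 1 - (i : ℕ) = (n - i) + 1 by omega]
        obtain ⟨d1, b1⟩ := ih i (by omega)
        obtain ⟨d2, b2⟩ := ih (n - i) (by omega)
        refine ⟨d1.mul d2, fun x hx => ?_⟩
        rw [norm_mul, norm_mul]
        have hpow : (η ^ 2 * M * κ) ^ n = (η ^ 2 * M * κ) ^ (i : ℕ) * (η ^ 2 * M * κ) ^ (n - i) := by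
          rw [← pow_add, Nat.add_sub_cancel' hi]
        calc _ ≤ (catalan i * (M * η) * (η ^ 2 * M * κ) ^ (i : ℕ)) *
              (catalan (n - i) * (M * η) * (η ^ 2 * M * κ) ^ (n - i)) * κ :=
              mul_le_mul (mul_le_mul (b1 x hx) (b2 x hx) (norm_nonneg _) (by positivity))
                (hc.inv_le x hx) (norm_nonneg _) (by positivity)
          _ = _ := by rw [hpow]; ring
      rw [show n + 1 + 1 = n + 2 from rfl, corrTerm_add_two]
      refine ⟨fun x hx => ?_, fun x hx => ?_⟩
      · refine DifferentiableAt.differentiableWithinAt ?_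
        refine DifferentiableAt.neg (DifferentiableAt.fun_sum fun i _ => ?_)
        exact (h.hasDerivAt_intOp hc.pos_height.le hc.inv_le (key i).1 (key i).2 σ hη
          hx).differentiableAt
      · rw [norm_neg]
        refine (norm_sum_le _ _).trans ((Finset.sum_le_sum fun i _ => h.norm_intOp_le
          hc.pos_height.le hc.subleading_le (key i).2 σ hη hc.mul_le hx).trans ?_)
        rw [← Finset.sum_mul, ← Finset.sum_mul, catalan_succ]
        push_cast
        apply le_of_eq
        ring

theorem norm_corrTerm_succ_le (σ : ℤˣ) (n : ℕ) {x : ℂ} (hx : x ∈ heightDomain Ω A μ δ) :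
    ‖corrTerm Q Ω r σ η (n + 1) x‖ ≤ M * η * (1 / 2) ^ n := by
  obtain ⟨hκ, hB, hM⟩ := hc.pos_const
  have hη := hc.pos
  have h1 : (catalan n : ℝ) ≤ 4 ^ n := by exact_mod_cast catalan_le_four_pow n
  calc _ ≤ catalan n * (M * η) * (η ^ 2 * M * κ) ^ n := (h.corrTerm_properties hc σ n).2 x hx
    _ ≤ 4 ^ n * (M * η) * (η ^ 2 * M * κ) ^ n := by gcongr
    _ = M * η * (4 * (η ^ 2 * M * κ)) ^ n := by rw [mul_pow 4]; ring
    -- The constant 8 in `sq_le` is chosen so that the ratio `4 η² M κ` is at most 1/2.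
    _ ≤ M * η * (1 / 2) ^ n := by
      gcongr
      linarith [hc.sq_le]

theorem norm_corrTerm_le (σ : ℤˣ) (n : ℕ) {x : ℂ} (hx : x ∈ heightDomain Ω A μ δ) :
    ‖corrTerm Q Ω r σ η n x‖ ≤ 2 * (M * η) * (1 / 2) ^ n := by
  obtain ⟨hκ, hB, hM⟩ := hc.pos_const
  have hη := hc.pos
  match n with
  | 0 =>
    rw [corrTerm_zero, norm_zero]; positivity
  | n + 1 =>
    refine (h.norm_corrTerm_succ_le hc σ n hx).trans (le_of_eq ?_)
    rw [pow_succ]; ring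

omit h hc in
theorem summable_majorant (M η : ℝ) : Summable fun n : ℕ => 2 * (M * η) * (1 / 2 : ℝ) ^ n :=
  (summable_geometric_of_lt_one (by norm_num) (by norm_num)).mul_left _

theorem summable_norm_corrTerm (σ : ℤˣ) {x : ℂ} (hx : x ∈ heightDomain Ω A μ δ) :
    Summable fun n => ‖corrTerm Q Ω r σ η n x‖ :=
  Summable.of_nonneg_of_le (fun _ => norm_nonneg _) (fun n => h.norm_corrTerm_le hc σ n hx)
    (summable_majorant M η)

theorem differentiableOn_corrTerm (σ : ℤˣ) (n : ℕ) :
    DifferentiableOn ℂ (corrTerm Q Ω r σ η n) (heightDomain Ω A μ δ) := by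
  match n with
  | 0 => rw [corrTerm]; exact differentiableOn_const 0
  | n + 1 => exact (h.corrTerm_properties hc σ n).1

/-- Since `W_0 = 0`, the sum may run over the full antidiagonal; summed over `n`, it is then the
Cauchy product `W²`. -/
theorem hasDerivAt_corrTerm (σ : ℤˣ) (n : ℕ) {x : ℂ} (hx : x ∈ heightDomain Ω A μ δ) :
    HasDerivAt (corrTerm Q Ω r σ η n) ((if n = 1 then sourceTerm Q x else 0)
      - ∑ p ∈ Finset.HasAntidiagonal.antidiagonal n,
          corrTerm Q Ω r σ η p.1 x * corrTerm Q Ω r σ η p.2 x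
      - (2 * subleading Q x + 2 / η * (((σ : ℤ) : ℂ) * r x)) * corrTerm Q Ω r σ η n x) x := by
  obtain ⟨hκ, hB, hM⟩ := hc.pos_const
  have hη := hc.pos
  match n with
  | 0 =>
    have : corrTerm Q Ω r σ η 0 = fun _ => 0 := funext (corrTerm_zero σ η)
    rw [this]
    simpa [corrTerm_zero] using hasDerivAt_const x (0 : ℂ)
  | 1 =>
    rw [corrTerm_one]
    refine (h.hasDerivAt_intOp hc.pos_height.le hc.inv_le
      (h.differentiableOn_sourceTerm.mono inter_subset_left) hc.source_le σ hη hx).congr_deriv ?_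
    rw [Finset.Nat.antidiagonal_succ]
    simp [corrTerm_zero]
    ring
  | n + 2 =>
    rw [sum_antidiagonal_add_two (fun k => corrTerm Q Ω r σ η k x) n, corrTerm_zero,
      corrTerm_add_two]
    have key : ∀ i : Fin (n + 1), DifferentiableOn ℂ (fun y => corrTerm Q Ω r σ η (i + 1) y *
          corrTerm Q Ω r σ η (n + 1 - i) y) (heightDomain Ω A μ δ) ∧
        ∀ y ∈ heightDomain Ω A μ δ, ‖corrTerm Q Ω r σ η (i + 1) y *
          corrTerm Q Ω r σ η (n + 1 - i) y * (r y)⁻¹‖ ≤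
            2 * (M * η) * (1 / 2) ^ ((i : ℕ) + 1) * (2 * (M * η) * (1 / 2) ^ (n + 1 - (i : ℕ))) * κ := by
      intro i
      refine ⟨(h.differentiableOn_corrTerm hc σ _).mul (h.differentiableOn_corrTerm hc σ _),
        fun y hy => ?_⟩
      rw [norm_mul, norm_mul]
      exact mul_le_mul (mul_le_mul (h.norm_corrTerm_le hc σ _ hy) (h.norm_corrTerm_le hc σ _ hy)
        (norm_nonneg _) (by positivity)) (hc.inv_le y hy) (norm_nonneg _) (by positivity)
    have h1 := (HasDerivAt.fun_sum (u := Finset.univ) fun (i : Fin (n + 1)) _ => h.hasDerivAt_intOp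
      hc.pos_height.le hc.inv_le (key i).1 (key i).2 σ hη hx).neg
    refine h1.congr_deriv ?_
    rw [if_neg (by omega), Finset.sum_sub_distrib, Finset.sum_sub_distrib, ← Finset.mul_sum,
      ← Finset.mul_sum]
    ring

/-- The sum `W` of the correction terms satisfies
`W' = C - W² - (2 s₁ + 2 s₀ / h) W`. -/
theorem hasDerivAt_tsum_corrTerm (σ : ℤˣ) {x : ℂ} (hx : x ∈ heightDomain Ω A μ δ) :
    HasDerivAt (fun y => ∑' n, corrTerm Q Ω r σ η n y)
      (sourceTerm Q x - (∑' n, corrTerm Q Ω r σ η n x) ^ 2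
        - (2 * subleading Q x + 2 / η * (((σ : ℤ) : ℂ) * r x)) * ∑' n, corrTerm Q Ω r σ η n x) x := by
  have hopen := h.isOpen_heightDomain δ
  have hd := Complex.differentiableOn_tsum_of_summable_norm (summable_majorant M η)
    (fun n => h.differentiableOn_corrTerm hc σ n) hopen
    (fun n y hy => h.norm_corrTerm_le hc σ n hy)
  have hsum := Complex.hasSum_deriv_of_summable_norm (summable_majorant M η)
    (fun n => h.differentiableOn_corrTerm hc σ n) hopen
    (fun n y hy => h.norm_corrTerm_le hc σ n hy) hx
  have hW := h.summable_norm_corrTerm hc σ hx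
  have h1 : HasSum (fun n : ℕ => if n = 1 then sourceTerm Q x else 0) (sourceTerm Q x) :=
    hasSum_ite_eq 1 _
  have h2 : HasSum (fun n => ∑ p ∈ Finset.HasAntidiagonal.antidiagonal n,
      corrTerm Q Ω r σ η p.1 x * corrTerm Q Ω r σ η p.2 x)
      ((∑' n, corrTerm Q Ω r σ η n x) ^ 2) := by
    rw [pow_two, tsum_mul_tsum_eq_tsum_sum_antidiagonal_of_summable_norm hW hW]
    exact (summable_norm_sum_mul_antidiagonal_of_summable_norm hW hW).of_norm.hasSum
  have h3 := hW.of_norm.hasSum.mul_left (2 * subleading Q x + 2 / η * (((σ : ℤ) : ℂ) * r x))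
  have h4 := (h1.sub h2).sub h3
  have h5 := (hd.differentiableAt (hopen.mem_nhds hx)).hasDerivAt
  refine h5.congr_deriv (hsum.unique ?_)
  convert! h4 using 2 with n
  exact (h.hasDerivAt_corrTerm hc σ n hx).deriv

theorem norm_tsum_corrTerm_le (σ : ℤˣ) {x : ℂ} (hx : x ∈ heightDomain Ω A μ δ) :
    ‖∑' n, corrTerm Q Ω r σ η n x‖ ≤ 4 * M * η := by
  have h1 : HasSum (fun n : ℕ => 2 * (M * η) * (1 / 2 : ℝ) ^ n) (2 * (M * η) * 2) :=
    hasSum_geometric_two.mul_left _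
  refine (tsum_of_norm_bounded h1 fun n => h.norm_corrTerm_le hc σ n hx).trans (le_of_eq ?_)
  ring

/-- The Riccati equation for the true solution. -/
theorem hasDerivAt_trueSolution (σ : ℤˣ) {x : ℂ} (hx : x ∈ heightDomain Ω A μ δ) :
    ∃ S' : ℂ, HasDerivAt (fun y => trueSolution Q Ω r σ y η) S' x ∧
      (η : ℂ) * S' + trueSolution Q Ω r σ x η ^ 2 - Q.eval x = 0 := by
  have hη : (η : ℂ) ≠ 0 := Complex.ofReal_ne_zero.2 hc.pos.ne'
  have h1 : HasDerivAt (subleading Q) (deriv (subleading Q) x) x :=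
    (h.differentiableOn_subleading.differentiableAt (h.isOpen.mem_nhds hx.1)).hasDerivAt
  have h2 := (((h.hasDerivAt_branch hx.1).const_mul ((σ : ℤ) : ℂ)).add (h1.mul_const (η : ℂ))).add
    ((h.hasDerivAt_tsum_corrTerm hc σ hx).const_mul (η : ℂ))
  refine ⟨_, h2, ?_⟩
  rw [sourceTerm_eq, ← h.branch.2 x hx.1]
  exact riccati_algebra hη (unit_mul_self σ) _ _ _ _

end IsStripChart

end Correction


/-! ### The asymptotic expansion -/

section Asymptotics

/-- The square of a partial sum of a power series, up to its order. -/
theorem sq_partial_sum {R : Type*} [CommRing R] (a : ℕ → R) (t : R) (N : ℕ) :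
    (∑ i ∈ Finset.range (N + 1), a i * t ^ i) ^ 2 =
      ∑ k ∈ Finset.range (N + 1), (∑ p ∈ Finset.HasAntidiagonal.antidiagonal k, a p.1 * a p.2) * t ^ k
      + t ^ (N + 1) * ∑ p ∈ (Finset.range (N + 1) ×ˢ Finset.range (N + 1)).filter
          (fun p => ¬ p.1 + p.2 ≤ N), a p.1 * a p.2 * t ^ (p.1 + p.2 - (N + 1)) := by
  rw [pow_two, Finset.sum_mul_sum, ← Finset.sum_product',
    ← Finset.sum_filter_add_sum_filter_not _ (fun p : ℕ × ℕ => p.1 + p.2 ≤ N)]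
  congr 1
  · rw [← Finset.sum_fiberwise_of_maps_to (t := Finset.range (N + 1)) (g := fun p => p.1 + p.2)
      (fun p hp => by
        simp only [Finset.mem_filter] at hp
        exact Finset.mem_range.2 (by omega))]
    refine Finset.sum_congr rfl fun k hk => ?_
    rw [Finset.sum_mul]
    have hset : ((Finset.range (N + 1) ×ˢ Finset.range (N + 1)).filter
        (fun p => p.1 + p.2 ≤ N)).filter (fun p => p.1 + p.2 = k) =
          Finset.HasAntidiagonal.antidiagonal k := by
      ext p
      simp only [Finset.mem_filter, Finset.mem_product, Finset.mem_range,
        Finset.HasAntidiagonal.mem_antidiagonal] at hk ⊢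
      omega
    rw [hset]
    refine Finset.sum_congr rfl fun p hp => ?_
    rw [← Finset.HasAntidiagonal.mem_antidiagonal.1 hp, pow_add]
    ring
  · rw [Finset.mul_sum]
    refine Finset.sum_congr rfl fun p hp => ?_
    simp only [Finset.mem_filter, not_le] at hp
    have : t ^ p.1 * t ^ p.2 = t ^ (N + 1) * t ^ (p.1 + p.2 - (N + 1)) := by
      rw [← pow_add, ← pow_add]
      congr 1
      omega
    linear_combination a p.1 * a p.2 * this

/-- A bounded solution of `u' + λ u = f` on the line is bounded by `sup ‖f‖ / λ`. -/
theorem norm_le_of_bounded_linear_ode {u u' : ℝ → ℂ} {lam Z K : ℝ} (hlam : 0 < lam)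
    (hu : ∀ t, HasDerivAt u (u' t) t) (hZ : ∀ t, ‖u t‖ ≤ Z)
    (hK : ∀ t, ‖u' t + lam * u t‖ ≤ K) : ‖u 0‖ ≤ K / lam := by
  have hK0 : 0 ≤ K := (norm_nonneg _).trans (hK 0)
  have hexp : ∀ t : ℝ, HasDerivAt (fun t : ℝ => Real.exp (lam * t))
      (Real.exp (lam * t) * (lam * 1)) t := fun t => ((hasDerivAt_id t).const_mul lam).exp
  have hv : ∀ t, HasDerivAt (fun t : ℝ => (Real.exp (lam * t) : ℂ) * u t)
      ((Real.exp (lam * t) : ℂ) * (u' t + lam * u t)) t := by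
    intro t
    refine ((hexp t).ofReal_comp.mul (hu t)).congr_deriv ?_
    push_cast
    ring
  -- Integrate from `-T` to 0; boundedness in the past makes the contribution of the initial value
  -- vanish as `T → ∞`.
  have hT : ∀ T : ℝ, 0 ≤ T → ‖u 0‖ ≤ Z * Real.exp (-(lam * T)) + K / lam := by
    intro T hT
    have hB : ∀ t : ℝ, HasDerivAt (fun t => Z * Real.exp (-(lam * T)) + K / lam * Real.exp (lam * t))
        (K * Real.exp (lam * t)) t := by
      intro t
      refine (((hexp t).const_mul (K / lam)).const_add _).congr_deriv ?_
      field_simp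
    have := image_norm_le_of_norm_deriv_right_le_deriv_boundary
      (f := fun t : ℝ => (Real.exp (lam * t) : ℂ) * u t)
      (f' := fun t => (Real.exp (lam * t) : ℂ) * (u' t + lam * u t)) (a := -T) (b := 0)
      (B := fun t => Z * Real.exp (-(lam * T)) + K / lam * Real.exp (lam * t))
      (B' := fun t => K * Real.exp (lam * t))
      (fun t _ => (hv t).continuousAt.continuousWithinAt) (fun t _ => (hv t).hasDerivWithinAt)
      (by
        rw [norm_mul, Complex.norm_real, Real.norm_eq_abs, Real.abs_exp, mul_neg]
        have h1 := mul_le_mul_of_nonneg_left (hZ (-T)) (Real.exp_pos (-(lam * T))).le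
        have h2 : 0 ≤ K / lam * Real.exp (-(lam * T)) := by positivity
        linarith)
      (fun t => hB t)
      (fun t _ => by
        rw [norm_mul, Complex.norm_real, Real.norm_eq_abs, Real.abs_exp, mul_comm]
        exact mul_le_mul_of_nonneg_right (hK t) (Real.exp_pos _).le)
      (x := 0) ⟨by linarith, le_rfl⟩
    simpa using this
  have hlim : Tendsto (fun T : ℝ => Z * Real.exp (-(lam * T)) + K / lam) atTop
      (𝓝 (Z * 0 + K / lam)) :=
    ((Real.tendsto_exp_neg_atTop_nhds_zero.comp
      (tendsto_id.const_mul_atTop hlam)).const_mul Z).add_const _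
  rw [mul_zero, zero_add] at hlim
  exact ge_of_tendsto hlim (by filter_upwards [eventually_ge_atTop 0] with T h using hT T h)

variable {Q : ℂ[X]} {Ω : Set ℂ} {r A G : ℂ → ℂ} {μ : EReal} {δ κ B M η : ℝ}

/-- The bound is uniform in the coefficients `c`, which will be powers of `h`; the constants thus do
not depend on `h`. -/
theorem exists_bound_sum {ι : Type*} {s : Finset ι} {f : ι → ℂ → ℂ}
    (hf : ∀ i ∈ s, HeightBounded Ω A μ (f i)) (hδ : 0 < δ) :
    ∃ K : ℝ, 0 < K ∧ ∀ c : ι → ℂ, (∀ i ∈ s, ‖c i‖ ≤ 1) → ∀ x ∈ heightDomain Ω A μ δ,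
      ‖∑ i ∈ s, f i x * c i‖ ≤ K := by
  have : ∀ i ∈ s, ∃ K : ℝ, 0 < K ∧ ∀ x ∈ heightDomain Ω A μ δ, ‖f i x‖ ≤ K :=
    fun i hi => (hf i hi).exists_pos hδ
  choose! K hK hKf using this
  have hsum : 0 ≤ ∑ i ∈ s, K i := Finset.sum_nonneg fun i hi => (hK i hi).le
  refine ⟨∑ i ∈ s, K i + 1, by linarith, fun c hc x hx => ?_⟩
  have := (norm_sum_le s fun i => f i x * c i).trans (Finset.sum_le_sum fun i hi =>
    show ‖f i x * c i‖ ≤ K i by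
      rw [norm_mul]
      exact (mul_le_mul (hKf i hi x hx) (hc i hi) (norm_nonneg _) (hK i hi).le).trans
        (mul_one _).le)
  linarith

namespace IsStripChart

variable (h : IsStripChart Q Ω r A μ G)
include h

theorem exists_isAdmissible (hδ : 0 < δ) : ∃ κ B M H : ℝ, 0 < H ∧
    ∀ η : ℝ, 0 < η → η < H → IsAdmissible Q Ω r A μ δ κ B M η := by
  obtain ⟨κ, hκ, hκb⟩ := h.heightBounded_inv.exists_pos hδ
  obtain ⟨B, hB, hBb⟩ := (((heightBounded_const 2).mul h.heightBounded_subleading).mul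
    h.heightBounded_inv).exists_pos hδ
  obtain ⟨M, hM, hMb⟩ := h.heightBounded_sourceTerm.exists_pos hδ
  -- The last entry gives `8 η M κ ≤ 1`, hence `sq_le` because `η ≤ 1`.
  refine ⟨κ, B, M, min 1 (min (1 / B) (1 / (8 * (M * κ)))), by positivity, fun η hη hηH => ?_⟩
  have h1 : η ≤ 1 := (hηH.trans_le (min_le_left _ _)).le
  have h2 : η * B ≤ 1 :=
    (le_div_iff₀ hB).1 (hηH.trans_le ((min_le_right _ _).trans (min_le_left _ _))).le
  have h3 : η * (8 * (M * κ)) ≤ 1 := (le_div_iff₀ (by positivity)).1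
    (hηH.trans_le ((min_le_right _ _).trans (min_le_right _ _))).le
  refine ⟨hδ, hκb, hBb, hMb, ⟨hκ, hB, hM⟩, hη, h1, h2, ?_⟩
  calc 8 * (η ^ 2 * M * κ) = η * (η * (8 * (M * κ))) := by ring
    _ ≤ 1 * 1 := mul_le_mul h1 h3 (by positivity) zero_le_one
    _ = 1 := one_mul 1

/-- For `n = 0` Cauchy's estimate is not available, as `s₀` may be unbounded; instead `r'/r = -2 s₁`
is bounded. -/
theorem heightBounded_deriv_formalCoeff (σ : ℤˣ) (n : ℕ) : HeightBounded Ω A μ fun x =>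
    deriv (formalCoeff Q (fun x => ((σ : ℤ) : ℂ) * r x) n) x * (r x)⁻¹ := by
  match n with
  | 0 =>
    intro δ hδ
    obtain ⟨K, hK⟩ := ((heightBounded_const (((σ : ℤ) : ℂ) * -2)).mul
      h.heightBounded_subleading) δ hδ
    refine ⟨K, fun x hx => ?_⟩
    refine (le_of_eq ?_).trans (hK x hx)
    have hs0 : formalCoeff Q (fun x => ((σ : ℤ) : ℂ) * r x) 0 = fun x => ((σ : ℤ) : ℂ) * r x := by
      rw [formalCoeff]
    have hr0 := h.ne_zero x hx.1
    beta_reduce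
    rw [hs0, ((h.hasDerivAt_branch hx.1).const_mul _).deriv]
    congr 1
    field_simp
  | n + 1 =>
    exact h.heightBounded_deriv (h.formalCoeff_properties σ (n + 1)).1
      ((h.formalCoeff_properties σ (n + 1)).2 (by omega))

/-- The residual of the truncated formal series in the Riccati equation. -/
theorem truncated_riccati (σ : ℤˣ) (η : ℂ) (N : ℕ) {x : ℂ} (hx : x ∈ Ω) :
    η * ∑ n ∈ Finset.range (N + 1),
        deriv (formalCoeff Q (fun x => ((σ : ℤ) : ℂ) * r x) n) x * η ^ n
      + (∑ n ∈ Finset.range (N + 1), formalCoeff Q (fun x => ((σ : ℤ) : ℂ) * r x) n x * η ^ n) ^ 2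
      - Q.eval x
      = η ^ (N + 1) * (deriv (formalCoeff Q (fun x => ((σ : ℤ) : ℂ) * r x) N) x +
        ∑ p ∈ (Finset.range (N + 1) ×ˢ Finset.range (N + 1)).filter (fun p => ¬ p.1 + p.2 ≤ N),
          formalCoeff Q (fun x => ((σ : ℤ) : ℂ) * r x) p.1 x *
            formalCoeff Q (fun x => ((σ : ℤ) : ℂ) * r x) p.2 x * η ^ (p.1 + p.2 - (N + 1))) := by
  have hs0 : formalCoeff Q (fun x => ((σ : ℤ) : ℂ) * r x) 0 = fun x => ((σ : ℤ) : ℂ) * r x := by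
    rw [formalCoeff]
  rw [sq_partial_sum (fun n => formalCoeff Q (fun x => ((σ : ℤ) : ℂ) * r x) n x),
    Finset.sum_range_succ' (fun k => (∑ p ∈ Finset.HasAntidiagonal.antidiagonal k, _) * η ^ k) N,
    Finset.sum_range_succ (fun n =>
      deriv (formalCoeff Q (fun x => ((σ : ℤ) : ℂ) * r x) n) x * η ^ n)]
  have h1 : ∀ k ∈ Finset.range N, (∑ p ∈ Finset.HasAntidiagonal.antidiagonal (k + 1),
      formalCoeff Q (fun x => ((σ : ℤ) : ℂ) * r x) p.1 x *
        formalCoeff Q (fun x => ((σ : ℤ) : ℂ) * r x) p.2 x) * η ^ (k + 1) =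
      -(η * (deriv (formalCoeff Q (fun x => ((σ : ℤ) : ℂ) * r x) k) x * η ^ k)) := by
    intro k _
    have := h.formalCoeff_riccati σ k hx
    rw [pow_succ]
    linear_combination (η ^ k * η) * this
  rw [Finset.sum_congr rfl h1, Finset.sum_neg_distrib, ← Finset.mul_sum,
    Finset.Nat.antidiagonal_zero, Finset.sum_singleton]
  have h2 : formalCoeff Q (fun x => ((σ : ℤ) : ℂ) * r x) 0 x *
      formalCoeff Q (fun x => ((σ : ℤ) : ℂ) * r x) 0 x = Q.eval x := by
    rw [hs0, ← h.branch.2 x hx]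
    linear_combination (r x ^ 2) * unit_mul_self σ
  rw [h2]
  ring

/-- One step of the error estimate: the error along the flow solves a linear equation. -/
theorem norm_error_le (hc : IsAdmissible Q Ω r A μ δ κ B M η) (σ : ℤˣ) (N : ℕ) {E b ρ : ℂ → ℂ}
    {β K Z : ℝ}
    (hE : ∀ x ∈ heightDomain Ω A μ δ, ∃ E' : ℂ, HasDerivAt E E' x ∧
      (η : ℂ) * E' = -((2 * (((σ : ℤ) : ℂ) * r x) + η * b x) * E x) - (η : ℂ) ^ (N + 1) * ρ x)
    (hb : ∀ x ∈ heightDomain Ω A μ δ, ‖b x * (r x)⁻¹‖ ≤ β)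
    (hρ : ∀ x ∈ heightDomain Ω A μ δ, ‖ρ x * (r x)⁻¹‖ ≤ K)
    (hZ : ∀ x ∈ heightDomain Ω A μ δ, ‖E x‖ ≤ Z) {x : ℂ} (hx : x ∈ heightDomain Ω A μ δ) :
    ‖E x‖ ≤ η / 2 * (β * Z + K * η ^ N) := by
  have hη := hc.pos
  have hηC : (η : ℂ) ≠ 0 := Complex.ofReal_ne_zero.2 hη.ne'
  set e : ℝ := ((σ : ℤ) : ℝ) with he
  have heC : (e : ℂ) = ((σ : ℤ) : ℂ) := by simp [he]
  have hmem : ∀ t : ℝ, G (A x + ((e * t : ℝ) : ℂ)) ∈ heightDomain Ω A μ δ := fun t =>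
    h.translate_mem hc.pos_height.le hx _
  choose! E' hE'd hE'e using hE
  have hu : ∀ t : ℝ, HasDerivAt (fun t : ℝ => E (G (A x + ((e * t : ℝ) : ℂ))))
      (E' (G (A x + ((e * t : ℝ) : ℂ))) * (e * (r (G (A x + ((e * t : ℝ) : ℂ))))⁻¹)) t := by
    intro t
    have h1 := (h.hasDerivAt_translate hx.1 (e * t)).scomp t ((hasDerivAt_id t).const_mul e)
    have h2 := (hE'd _ (hmem t)).comp t h1
    rw [mul_one, Complex.real_smul] at h2
    exact h2
  have hmain := norm_le_of_bounded_linear_ode (lam := 2 / η) (Z := Z) (K := β * Z + K * η ^ N)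
    (by positivity) hu (fun t => hZ _ (hmem t)) (fun t => by
      have hy := hmem t
      set y := G (A x + ((e * t : ℝ) : ℂ))
      have hr0 := h.ne_zero y hy.1
      have hs := unit_mul_self σ
      have hE'y : E' y = (-((2 * (((σ : ℤ) : ℂ) * r y) + η * b y) * E y)
          - (η : ℂ) ^ (N + 1) * ρ y) / η := by
        rw [← hE'e y hy]; field_simp
      -- Flowing in the direction `σ` turns the coefficient `2 s₀/η` into `+2/η` for both signs.
      have hid : E' y * (e * (r y)⁻¹) + ((2 / η : ℝ) : ℂ) * E y =
          -(((σ : ℤ) : ℂ) * (b y * (r y)⁻¹) * E y)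
            - ((σ : ℤ) : ℂ) * (ρ y * (r y)⁻¹) * (η : ℂ) ^ N := by
        rw [hE'y, heC, pow_succ]
        push_cast
        field_simp
        linear_combination (-2 * r y * E y) * hs
      rw [hid]
      refine (norm_sub_le _ _).trans ?_
      rw [norm_neg, norm_mul, norm_mul, norm_mul (_ * _), norm_mul ((σ : ℤ) : ℂ), norm_unit,
        one_mul, one_mul, norm_pow, Complex.norm_real, Real.norm_eq_abs, abs_of_pos hη]
      exact add_le_add (mul_le_mul (hb y hy) (hZ y hy) (norm_nonneg _)
        ((norm_nonneg _).trans (hb y hy))) (mul_le_mul_of_nonneg_right (hρ y hy) (by positivity)))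
  have hx0 : G (A x + ((e * 0 : ℝ) : ℂ)) = x := by simp [h.left_inv x hx.1]
  simp only [hx0] at hmain
  refine hmain.trans (le_of_eq ?_)
  field_simp

/-- The error estimate for a bounded error. -/
theorem norm_error_le_pow (hc : IsAdmissible Q Ω r A μ δ κ B M η) (σ : ℤˣ) (N : ℕ)
    {E b ρ : ℂ → ℂ} {β K Z : ℝ} (hβ : 0 ≤ β) (hK : 0 ≤ K) (hZ0 : 0 ≤ Z)
    (hE : ∀ x ∈ heightDomain Ω A μ δ, ∃ E' : ℂ, HasDerivAt E E' x ∧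
      (η : ℂ) * E' = -((2 * (((σ : ℤ) : ℂ) * r x) + η * b x) * E x) - (η : ℂ) ^ (N + 1) * ρ x)
    (hb : ∀ x ∈ heightDomain Ω A μ δ, ‖b x * (r x)⁻¹‖ ≤ β)
    (hρ : ∀ x ∈ heightDomain Ω A μ δ, ‖ρ x * (r x)⁻¹‖ ≤ K)
    (hZ : ∀ x ∈ heightDomain Ω A μ δ, ‖E x‖ ≤ Z) {x : ℂ} (hx : x ∈ heightDomain Ω A μ δ) :
    ‖E x‖ ≤ (K + Z * β ^ (N + 1)) * η ^ (N + 1) := by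
  have hη := hc.pos
  -- For `η β ≤ 1` each use of `norm_error_le` halves the part of the bound coming from `Z`. For `η
  -- β ≥ 1` the trivial bound `Z ≤ Z (η β)^(N+1)` suffices; so the range of `η` need not shrink with
  -- `N`, although `β` will depend on `N`.
  rcases le_total (η * β) 1 with hηβ | hηβ
  · have hk : ∀ k : ℕ, ∀ y ∈ heightDomain Ω A μ δ,
        ‖E y‖ ≤ Z * (1 / 2) ^ k + K * η ^ (N + 1) := by
      intro k
      induction k with
      | zero =>
        intro y hy
        have : 0 ≤ K * η ^ (N + 1) := by positivity
        simpa using (hZ y hy).trans (le_add_of_nonneg_right this)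
      | succ k ih =>
        intro y hy
        refine (h.norm_error_le hc σ N hE hb hρ ih hy).trans ?_
        have h0 : 0 ≤ Z * (1 / 2) ^ k + K * η ^ (N + 1) := by positivity
        calc η / 2 * (β * (Z * (1 / 2) ^ k + K * η ^ (N + 1)) + K * η ^ N)
            = 1 / 2 * ((η * β) * (Z * (1 / 2) ^ k + K * η ^ (N + 1))) + 1 / 2 * (K * η ^ (N + 1)) := by
              ring
          _ ≤ 1 / 2 * (1 * (Z * (1 / 2) ^ k + K * η ^ (N + 1))) + 1 / 2 * (K * η ^ (N + 1)) := by
              gcongr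
          _ = Z * (1 / 2) ^ (k + 1) + K * η ^ (N + 1) := by ring
    have hlim : Tendsto (fun k : ℕ => Z * (1 / 2 : ℝ) ^ k + K * η ^ (N + 1)) atTop
        (𝓝 (Z * 0 + K * η ^ (N + 1))) :=
      ((tendsto_pow_atTop_nhds_zero_of_lt_one (by norm_num) (by norm_num)).const_mul Z).add_const _
    rw [mul_zero, zero_add] at hlim
    refine (ge_of_tendsto' hlim fun k => hk k x hx).trans ?_
    gcongr
    exact le_add_of_nonneg_right (by positivity)
  · calc ‖E x‖ ≤ Z * 1 := by rw [mul_one]; exact hZ x hx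
      _ ≤ Z * (η * β) ^ (N + 1) := by
        gcongr
        exact one_le_pow₀ hηβ
      _ = Z * β ^ (N + 1) * η ^ (N + 1) := by rw [mul_pow]; ring
      _ ≤ _ := by
        gcongr
        exact le_add_of_nonneg_left hK

theorem exists_asymptotic_bound (σ : ℤˣ) {H : ℝ}
    (hc : ∀ η : ℝ, 0 < η → η < H → IsAdmissible Q Ω r A μ δ κ B M η) (hδ : 0 < δ) (N : ℕ) :
    ∃ C : ℝ, ∀ η : ℝ, 0 < η → η < H → ∀ x ∈ heightDomain Ω A μ δ,
      ‖trueSolution Q Ω r σ x η - ∑ n ∈ Finset.range (N + 1),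
        formalCoeff Q (fun x => ((σ : ℤ) : ℂ) * r x) n x * (η : ℂ) ^ n‖ ≤ C * η ^ (N + 1) := by
  set s : ℕ → ℂ → ℂ := formalCoeff Q (fun x => ((σ : ℤ) : ℂ) * r x) with hs
  have hs0 : s 0 = fun x => ((σ : ℤ) : ℂ) * r x := by rw [hs, formalCoeff]
  have hsb : ∀ n, HeightBounded Ω A μ (s (n + 1)) := fun n =>
    (h.formalCoeff_properties σ (n + 1)).2 (by omega)
  obtain ⟨κ', hκ', hκb⟩ := h.heightBounded_inv.exists_pos hδ
  obtain ⟨m₁, hm₁, hm₁b⟩ := h.heightBounded_subleading.exists_pos hδ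
  obtain ⟨m₂, hm₂, hm₂b⟩ := exists_bound_sum (s := Finset.range N) (f := fun n => s (n + 1))
    (fun n _ => hsb n) hδ
  obtain ⟨m₃, hm₃, hm₃b⟩ := (h.heightBounded_deriv_formalCoeff σ N).exists_pos hδ
  -- Both indices are at most `N` and their sum exceeds `N`, so both are positive and the possibly
  -- unbounded `s₀` does not occur.
  obtain ⟨m₄, hm₄, hm₄b⟩ := exists_bound_sum
    (s := (Finset.range (N + 1) ×ˢ Finset.range (N + 1)).filter (fun p => ¬ p.1 + p.2 ≤ N))
    (f := fun p x => s p.1 x * s p.2 x * (r x)⁻¹) (fun p hp => by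
      simp only [Finset.mem_filter, Finset.mem_product, Finset.mem_range] at hp
      obtain ⟨i, hi⟩ : ∃ i, p.1 = i + 1 := ⟨p.1 - 1, by omega⟩
      obtain ⟨j, hj⟩ : ∃ j, p.2 = j + 1 := ⟨p.2 - 1, by omega⟩
      rw [hi, hj]
      exact ((hsb i).mul (hsb j)).mul h.heightBounded_inv) hδ
  -- With `P = s₀ + η q`, this bounds both `b = s₁ + W + q` and `E/η = s₁ + W - q`. The absolute
  -- value is there because `0 < M` is known only once some admissible `η` is given.
  set Z : ℝ := m₁ + |4 * M| + m₂ with hZ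
  have hZ0 : 0 ≤ Z := by positivity
  refine ⟨(m₃ + m₄) + Z * (Z * κ') ^ (N + 1), fun η hη hηH x hx => ?_⟩
  have hcη := hc η hη hηH
  have hpow : ∀ k : ℕ, ‖(η : ℂ) ^ k‖ ≤ 1 := fun k => by
    rw [norm_pow, Complex.norm_real, Real.norm_eq_abs, abs_of_pos hη]
    exact pow_le_one₀ hη.le hcη.le_one
  set W : ℂ → ℂ := fun y => ∑' n, corrTerm Q Ω r σ η n y with hW
  set P : ℂ → ℂ := fun y => ∑ n ∈ Finset.range (N + 1), s n y * (η : ℂ) ^ n with hP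
  set q : ℂ → ℂ := fun y => ∑ n ∈ Finset.range N, s (n + 1) y * (η : ℂ) ^ n with hq
  have hWb : ∀ y ∈ heightDomain Ω A μ δ, ‖W y‖ ≤ |4 * M| := by
    intro y hy
    refine (h.norm_tsum_corrTerm_le hcη σ hy).trans ?_
    have hM := hcη.pos_const.2.2
    rw [abs_of_pos (by linarith)]
    nlinarith [hcη.le_one]
  have hqb : ∀ y ∈ heightDomain Ω A μ δ, ‖q y‖ ≤ m₂ := fun y hy =>
    hm₂b (fun n => (η : ℂ) ^ n) (fun n _ => hpow n) y hy
  have hPq : ∀ y, P y = ((σ : ℤ) : ℂ) * r y + η * q y := by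
    intro y
    simp only [hP, hq]
    rw [Finset.sum_range_succ', hs0, pow_zero, mul_one, Finset.mul_sum, add_comm]
    congr 1
    refine Finset.sum_congr rfl fun n _ => ?_
    rw [pow_succ]; ring
  have hSW : ∀ y, trueSolution Q Ω r σ y η =
      ((σ : ℤ) : ℂ) * r y + subleading Q y * η + η * W y := fun y => rfl
  have hfin := h.norm_error_le_pow hcη σ N (E := fun y => trueSolution Q Ω r σ y η - P y)
    (b := fun y => subleading Q y + W y + q y)
    (ρ := fun y => deriv (s N) y + ∑ p ∈ (Finset.range (N + 1) ×ˢ Finset.range (N + 1)).filter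
      (fun p => ¬ p.1 + p.2 ≤ N), s p.1 y * s p.2 y * (η : ℂ) ^ (p.1 + p.2 - (N + 1)))
    (β := Z * κ') (K := m₃ + m₄) (Z := Z) (by positivity) (by positivity) hZ0
    (fun y hy => by
      obtain ⟨S', hS', hric⟩ := h.hasDerivAt_trueSolution hcη σ hy
      have hPd : HasDerivAt P (∑ n ∈ Finset.range (N + 1), deriv (s n) y * (η : ℂ) ^ n) y := by
        refine HasDerivAt.fun_sum fun n _ => HasDerivAt.mul_const ?_ _
        exact ((h.formalCoeff_properties σ n).1.differentiableAt
          (h.isOpen.mem_nhds hy.1)).hasDerivAt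
      refine ⟨_, hS'.sub hPd, ?_⟩
      have htr := h.truncated_riccati σ (η : ℂ) N hy.1
      change _ + P y ^ 2 - _ = (η : ℂ) ^ (N + 1) * (deriv (s N) y + _) at htr
      rw [← htr]
      -- The difference of the two Riccati equations is linear in `E` because `S² - P² = (S + P)(S -
      -- P)`.
      have hb : 2 * (((σ : ℤ) : ℂ) * r y) + η * (subleading Q y + W y + q y) =
          trueSolution Q Ω r σ y η + P y := by
        rw [hPq, hSW]; ring
      rw [hb]
      linear_combination hric)
    (fun y hy => by
      rw [norm_mul]
      refine mul_le_mul ?_ (hκb y hy) (norm_nonneg _) hZ0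
      exact (norm_add₃_le).trans (add_le_add (add_le_add (hm₁b y hy) (hWb y hy)) (hqb y hy)))
    (fun y hy => by
      rw [add_mul, Finset.sum_mul]
      refine (norm_add_le _ _).trans (add_le_add (hm₃b y hy) ?_)
      have := hm₄b (fun p => (η : ℂ) ^ (p.1 + p.2 - (N + 1))) (fun p _ => hpow _) y hy
      refine (le_of_eq ?_).trans this
      congr 1
      exact Finset.sum_congr rfl fun p _ => by ring)
    (fun y hy => by
      have : trueSolution Q Ω r σ y η - P y = η * (subleading Q y + W y - q y) := by
        rw [hPq, hSW]; ring
      rw [this, norm_mul]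
      have h1 : ‖subleading Q y + W y - q y‖ ≤ Z :=
        (norm_sub_le _ _).trans (add_le_add ((norm_add_le _ _).trans
          (add_le_add (hm₁b y hy) (hWb y hy))) (hqb y hy))
      have h2 := hpow 1
      rw [pow_one] at h2
      exact (mul_le_mul h2 h1 (norm_nonneg _) zero_le_one).trans (one_mul Z).le)
    hx
  exact hfin

end IsStripChart

end Asymptotics

end WKB

/-! ### The main theorem -/

theorem mainTheorem5 (Q : ℂ[X]) (Ω : Set ℂ) (hΩ : WKB.IsStokesDomain Q Ω)
    (a : ℂ) (ha : Q.IsRoot a) (haΩ : a ∈ frontier Ω)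
    (r A : ℂ → ℂ) (hr : WKB.IsSqrtBranch Q Ω r) (hA : WKB.IsIntegralFrom Ω a r A)
    (hpos : ∀ x ∈ Ω, 0 < (A x).im) (σ : ℤˣ) :
    (∀ δ : ℝ, 0 < δ → ∃ H : ℝ, 0 < H ∧ ∀ h : ℝ, 0 < h → h < H →
      ∀ x ∈ WKB.innerDomain Ω A δ,
        Summable (fun n => WKB.corrTerm Q Ω r σ h n x) ∧
        ∃ S' : ℂ, HasDerivAt (fun y => WKB.trueSolution Q Ω r σ y h) S' x ∧
          (h : ℂ) * S' + WKB.trueSolution Q Ω r σ x h ^ 2 - Q.eval x = 0) ∧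
    WKB.HasAsympExpansion Ω (WKB.innerDomain Ω A) (WKB.trueSolution Q Ω r σ)
      (WKB.formalCoeff Q (fun x => ((σ : ℤ) : ℂ) * r x)) := by
  obtain ⟨G, hG⟩ := WKB.exists_isStripChart hΩ ha haΩ hr hA hpos
  have hdom : ∀ δ, WKB.innerDomain Ω A δ =
      WKB.heightDomain Ω A (⨆ y ∈ Ω, ((A y).im : EReal)) δ := fun δ => rfl
  simp only [hdom]
  refine ⟨fun δ hδ => ?_, fun n => (hG.formalCoeff_properties σ n).1, fun δ hδ => ?_⟩
  · obtain ⟨κ, B, M, H, hH, hc⟩ := hG.exists_isAdmissible hδ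
    exact ⟨H, hH, fun η hη hηH x hx => ⟨(hG.summable_norm_corrTerm (hc η hη hηH) σ hx).of_norm,
      hG.hasDerivAt_trueSolution (hc η hη hηH) σ hx⟩⟩
  · obtain ⟨κ, B, M, H, hH, hc⟩ := hG.exists_isAdmissible hδ
    simp only [hdom]
    refine ⟨H, hH, fun η hη hηH x hx => ?_, hG.exists_asymptotic_bound σ hc hδ⟩
    obtain ⟨S', hS', -⟩ := hG.hasDerivAt_trueSolution (hc η hη hηH) σ hx
    exact hS'.differentiableAt.differentiableWithinAt
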